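/- Theorem. There are an absolute constant $c>0$ and, for every $n$, a single randomized instance of cardinality-constrained monotone submodular maximization on $n$ elements, that is, a bound $k_n$ and a finite nonempty family $\mathcal F_n$ of nonnegative monotone submodular functions $f:2^{[n]}\to\mathbb R_+$ with $\mathrm{OPT}(f):=\max\{f(S):|S|\le k_n\}>0$, from which $f$ is drawn uniformly at random, such that the following holds. For every polynomial $p$ there is an $n_0$ such that for all $n\ge n_0$, all integers $r$ with $1\le r<\frac13\log_2 n$, and every randomized algorithm that makes $r$ adaptive rounds of at most $p(n)$ value queries each (the queries of a round depend only on the random seed and on the answers of earlier rounds; computation is otherwise unrestricted) and returns a set $S$ with $|S|\le k_n$, the algorithm achieves at most a $\left(1-\frac1e-\frac cr\right)$-approximation on the randomized instance. Precisely, over the random choice of $f\in\mathcal F_n$ and of the seed, $$\mathbf E\left[\frac{f(S)}{\mathrm{OPT}(f)}\right]\le 1-\frac1e-\frac cr \qquad\text{and}\qquad \Pr\left[f(S)>\left(1-\frac1e-\frac cr\right)\mathrm{OPT}(f)\right]\le\frac1n .$$ The constant $c$ and the randomized instances depend neither on $r$ nor on $p$. -/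

import Mathlib

/-- `f` is a submodular set function on the ground set `Fin n`: marginal values diminish. -/
def IsSubmodular {n : ℕ} (f : Finset (Fin n) → ℝ) : Prop :=
  ∀ S T : Finset (Fin n), S ⊆ T → ∀ e : Fin n, e ∉ T →
    f (insert e T) - f T ≤ f (insert e S) - f S

/-- The optimum of `max {f S : |S| ≤ k}`. -/
noncomputable def optValue {n : ℕ} (k : ℕ) (f : Finset (Fin n) → ℝ) : ℝ :=
  (Finset.univ.filter fun S : Finset (Fin n) => S.card ≤ k).sup'
    ⟨∅, Finset.mem_filter.mpr ⟨Finset.mem_univ _, Nat.zero_le k⟩⟩ f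

/-- A randomized instance of cardinality-constrained monotone submodular maximization on `n`
elements: a finite nonempty family of nonnegative monotone submodular functions `f i`, all to be
maximized over the sets of at most `k` elements. The random instance is `f i` with `i` uniformly
distributed in `ι`. The optima are positive, so that approximation ratios make sense. -/
structure RandomInstance (n : ℕ) where
  ι : Type
  fintype : Fintype ι
  nonempty : Nonempty ι
  k : ℕ
  f : ι → Finset (Fin n) → ℝ
  nonneg : ∀ i S, 0 ≤ f i S
  monotone : ∀ i, Monotone (f i)
  submodular : ∀ i, IsSubmodular (f i)
  opt_pos : ∀ i, 0 < optValue k (f i)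

attribute [instance] RandomInstance.fintype RandomInstance.nonempty

/-- What an algorithm has seen so far: one entry for each past round, in order; an entry is the list
of the sets queried in that round, with the values that the oracle returned. -/
abbrev QueryHistory (n : ℕ) : Type := List (List (Finset (Fin n) × ℝ))

/-- A deterministic adaptive algorithm in the value oracle model, with at most `q` queries in each
round and an output of at most `k` elements. The queries of a round depend only on the results of
the earlier rounds. The computation between the rounds is unrestricted. -/
structure AdaptiveAlgorithm (n k q : ℕ) where
  queries : QueryHistory n → List (Finset (Fin n))
  length_queries_le : ∀ H, (queries H).length ≤ q
  output : QueryHistory n → Finset (Fin n)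
  card_output_le : ∀ H, (output H).card ≤ k

namespace AdaptiveAlgorithm

/-- The history after the given number of rounds against the value oracle `f`. -/
def history {n k q : ℕ} (A : AdaptiveAlgorithm n k q) (f : Finset (Fin n) → ℝ) :
    ℕ → QueryHistory n
  | 0 => []
  | t + 1 => A.history f t ++ [(A.queries (A.history f t)).map fun S => (S, f S)]

/-- The set returned after `r` rounds against the value oracle `f`. -/
def run {n k q : ℕ} (A : AdaptiveAlgorithm n k q) (r : ℕ) (f : Finset (Fin n) → ℝ) :
    Finset (Fin n) :=
  A.output (A.history f r)

end AdaptiveAlgorithm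

/-- A randomized `r`-round algorithm: a deterministic algorithm chosen by a random seed. For each
oracle the returned set is a random variable. -/
structure RandomizedAlgorithm (n k r q : ℕ) where
  Ω : Type
  mΩ : MeasurableSpace Ω
  P : MeasureTheory.Measure Ω
  prob : MeasureTheory.IsProbabilityMeasure P
  alg : Ω → AdaptiveAlgorithm n k q
  measurable_run : ∀ (f : Finset (Fin n) → ℝ) (S : Finset (Fin n)),
    MeasurableSet {ω | (alg ω).run r f = S}

attribute [instance] RandomizedAlgorithm.mΩ RandomizedAlgorithm.prob

namespace RandomInstance

/-- The expectation, over the random instance and the seed of the algorithm, of the ratio of the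
value of the returned set to the optimum. -/
noncomputable def expectedRatio {n r q : ℕ} (I : RandomInstance n)
    (A : RandomizedAlgorithm n I.k r q) : ℝ :=
  (∑ i, ∫ ω, I.f i ((A.alg ω).run r (I.f i)) / optValue I.k (I.f i) ∂A.P) / Fintype.card I.ι

/-- The probability, over the random instance and the seed of the algorithm, that the value of the
returned set exceeds `α` times the optimum. -/
noncomputable def probRatioGT {n r q : ℕ} (I : RandomInstance n)
    (A : RandomizedAlgorithm n I.k r q) (α : ℝ) : ℝ :=
  (∑ i, A.P.real {ω | α * optValue I.k (I.f i) < I.f i ((A.alg ω).run r (I.f i))}) /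
    Fintype.card I.ι

end RandomInstance

/-!
The elements of the ground set receive independent random labels. The labels are grouped into layers
`0, …, l`, each of which but the last contains three quarters of the labels not in earlier layers,
so that a set chosen without knowledge of the layers from `t` on has, up to fluctuations, fewer
elements in layer `j + 1` than half of what it has in layer `j`, for all `j ≥ t`. A tiny fraction of
the last layer is the hidden set `Y`.

The function to be maximized is `1 - exp (-L)`, where `L` is the normalized cardinality `|S| / k`
minus a penalty for every layer `j < l` of which `S` contains, by a margin `m`, more than half as
many elements as of layer `j - 1`. The elements of `Y` behave like those of the last layer until `S`
contains `m` of them; from then on they decrease `exp (-L)` linearly, and `k` of them reduce it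
almost to zero, so that the optimum is close to `1`. Values close to `1` are truncated.

* The function is monotone and submodular (`hardFn_monotone`, `hardFn_isSubmodular`): the penalty
  has small first and second differences, and `1 - exp (-L)` has diminishing returns even if second
  differences of `L` are positive, provided that they are at most the products of the first
  differences (`exp_neg_second_diff`).
* If nothing is known about the layers from `t` on, then a query set is, with overwhelming
  probability, balanced on them, so its value depends on the layers up to `t` only: the penalties
  for the later ones vanish (`labelFn_eq_roundFn`). The probability is bounded by exponential
  moments, which factorize over the elements because the labels are independent, even when the first
  `t` layers are given (`card_unbalanced_le`). Each round thus reveals at most one new layer, and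
  the algorithm can be simulated with the corresponding partial information (`card_good_le`).
* After `r` rounds the returned set is balanced after layer `r`. At least a constant fraction of it
  must then lie in the first `r + 1` layers, and as the penalties are quadratic, they add up to at
  least a constant times `1 / r`, even when the set is spread evenly (`potential_le_of_balanced`).
  Its value is therefore at most `1 - 1 / e - Ω (1 / r)`.

The random seed is dealt with by averaging: the estimate for deterministic algorithms holds for each
value of the seed.
-/

namespace AdaptiveHardness

open Finset

variable {n : ℕ}

/-! ### A penalty function with bounded first and second differences -/

/-- The derivative of `penalty`: zero for negative arguments, then linear, and constant from `1`
on. -/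
noncomputable def ramp (u : ℝ) : ℝ := min (max u 0) 1 / 8

/-- A Huber-type penalty: zero for negative arguments, quadratic on `[0, 1]`, linear afterwards.
The linear part keeps all slopes at most `1 / 8`, so that penalties never destroy monotonicity. -/
noncomputable def penalty (t : ℝ) : ℝ := ∫ u in (0 : ℝ)..t, ramp u

lemma continuous_ramp : Continuous ramp := by
  unfold ramp; fun_prop

lemma ramp_nonneg (u : ℝ) : 0 ≤ ramp u := by
  unfold ramp; positivity

lemma ramp_le (u : ℝ) : ramp u ≤ 1 / 8 := by
  unfold ramp
  have := min_le_right (max u 0) 1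
  linarith

lemma abs_ramp_add_sub_le (u v : ℝ) : |ramp (u + v) - ramp u| ≤ |v| / 8 := by
  unfold ramp
  rw [← sub_div, abs_div, abs_of_pos (by norm_num : (0 : ℝ) < 8)]
  refine div_le_div_of_nonneg_right ?_ (by norm_num)
  refine (abs_min_sub_min_le_max (max (u + v) 0) 1 (max u 0) 1).trans ?_
  rw [sub_self, abs_zero, max_eq_left (abs_nonneg _)]
  refine (abs_max_sub_max_le_max (u + v) 0 u 0).trans ?_
  simp

lemma penalty_sub_penalty (s t : ℝ) : penalty t - penalty s = ∫ u in s..t, ramp u :=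
  intervalIntegral.integral_interval_sub_left (continuous_ramp.intervalIntegrable _ _)
    (continuous_ramp.intervalIntegrable _ _)

lemma abs_penalty_add_sub_le (z a : ℝ) : |penalty (z + a) - penalty z| ≤ |a| / 8 := by
  rw [penalty_sub_penalty]
  have := intervalIntegral.norm_integral_le_of_norm_le_const (a := z) (b := z + a) (f := ramp)
    (C := 1 / 8) fun u _ => by
      rw [Real.norm_of_nonneg (ramp_nonneg u)]; exact ramp_le u
  rw [Real.norm_eq_abs, add_sub_cancel_left] at this
  linarith

lemma abs_penalty_second_diff_le (z a b : ℝ) :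
    |penalty (z + a + b) - penalty (z + b) - (penalty (z + a) - penalty z)| ≤ |a| * |b| / 8 := by
  have hc : Continuous fun u => ramp (u + b) := continuous_ramp.comp (continuous_add_const b)
  rw [penalty_sub_penalty, penalty_sub_penalty,
    ← intervalIntegral.integral_comp_add_right (fun u => ramp u) b,
    ← intervalIntegral.integral_sub (hc.intervalIntegrable _ _)
      (continuous_ramp.intervalIntegrable _ _)]
  have := intervalIntegral.norm_integral_le_of_norm_le_const (a := z) (b := z + a)
    (f := fun u => ramp (u + b) - ramp u) (C := |b| / 8)
    fun u _ => abs_ramp_add_sub_le u b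
  rw [Real.norm_eq_abs, add_sub_cancel_left] at this
  linarith

lemma penalty_of_nonpos {t : ℝ} (ht : t ≤ 0) : penalty t = 0 := by
  unfold penalty
  rw [intervalIntegral.integral_symm, neg_eq_zero]
  refine intervalIntegral.integral_zero_ae (Filter.Eventually.of_forall fun u hu => ?_)
  rw [Set.uIoc_of_le ht] at hu
  simp [ramp, max_eq_right hu.2]

lemma penalty_nonneg (t : ℝ) : 0 ≤ penalty t := by
  rcases le_total t 0 with ht | ht
  · exact (penalty_of_nonpos ht).ge
  · exact intervalIntegral.integral_nonneg ht fun u _ => ramp_nonneg u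

lemma penalty_eq_sq {t : ℝ} (h0 : 0 ≤ t) (h1 : t ≤ 1) : penalty t = t ^ 2 / 16 := by
  have : penalty t = ∫ u in (0 : ℝ)..t, u / 8 := by
    refine intervalIntegral.integral_congr fun u hu => ?_
    rw [Set.uIcc_of_le h0] at hu
    simp only [ramp]
    rw [max_eq_left hu.1, min_eq_left (hu.2.trans h1)]
  rw [this, intervalIntegral.integral_div, integral_id]
  ring

/-- The penalty lies above its tangent lines. -/
lemma tangent_le_penalty {s z : ℝ} (hs : 0 ≤ s) (hz : z ≤ 1) :
    s * z / 8 - s ^ 2 / 16 ≤ penalty z := by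
  rcases le_total z 0 with h | h
  · rw [penalty_of_nonpos h]
    nlinarith [sq_nonneg s, mul_nonneg hs (neg_nonneg.2 h)]
  · rw [penalty_eq_sq h hz]
    nlinarith [sq_nonneg (s - z)]

/-! ### The hard functions -/

/-- The coefficient with which an element of layer `i` enters the imbalance of layer `j`. -/
noncomputable def levelWeight (j i : ℕ) : ℝ :=
  (if i = j then 1 else 0) - (if i + 1 = j then 1 / 2 else 0)

lemma abs_levelWeight_le_one (j i : ℕ) : |levelWeight j i| ≤ 1 := by
  unfold levelWeight
  split_ifs with h1 h2 <;> first | omega | norm_num [abs_of_pos]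

lemma sum_abs_levelWeight_le (t i : ℕ) : ∑ j ∈ range t, |levelWeight j i| ≤ 3 / 2 := by
  have h : ∀ j, |levelWeight j i| ≤ (if i = j then 1 else 0) + (if i + 1 = j then 1 / 2 else 0) := by
    intro j
    unfold levelWeight
    split_ifs with h1 h2 <;> first | omega | norm_num [abs_of_pos]
  refine (sum_le_sum fun j _ => h j).trans ?_
  rw [sum_add_distrib, sum_ite_eq, sum_ite_eq]
  split_ifs <;> norm_num

/-- The imbalance of layer `j` in `S`: with `x j` the number of elements of `S` in layer `j`, it is
`(x j - x (j - 1) / 2 - m) / k`. Here `lay` gives the layer of each element, and `m` is a slack that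
absorbs random fluctuations. For `j = 0` the middle term is missing. -/
noncomputable def imbalance (k m : ℕ) (lay : Fin n → ℕ) (j : ℕ) (S : Finset (Fin n)) : ℝ :=
  (∑ e ∈ S, levelWeight j (lay e) - m) / k

/-- The normalized cardinality of `S`, diminished by the penalties for imbalances in the first `t`
layers. -/
noncomputable def potential (k m : ℕ) (lay : Fin n → ℕ) (t : ℕ) (S : Finset (Fin n)) : ℝ :=
  (S.card : ℝ) / k - ∑ j ∈ range t, penalty (imbalance k m lay j S)

lemma imbalance_insert (k m : ℕ) (lay : Fin n → ℕ) (j : ℕ) {S : Finset (Fin n)} {e : Fin n}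
    (he : e ∉ S) :
    imbalance k m lay j (insert e S) = imbalance k m lay j S + levelWeight j (lay e) / k := by
  unfold imbalance
  rw [sum_insert he]; ring

lemma potential_empty (k m : ℕ) (lay : Fin n → ℕ) (t : ℕ) : potential k m lay t ∅ = 0 := by
  unfold potential imbalance
  rw [sum_eq_zero]
  · simp
  · intro j _
    refine penalty_of_nonpos (div_nonpos_of_nonpos_of_nonneg ?_ (Nat.cast_nonneg _))
    simp

lemma potential_insert_sub_ge (k m : ℕ) (lay : Fin n → ℕ) (t : ℕ)
    {S : Finset (Fin n)} {e : Fin n} (he : e ∉ S) :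
    13 / 16 * (1 / k : ℝ) ≤ potential k m lay t (insert e S) - potential k m lay t S := by
  have h : ∑ j ∈ range t, (penalty (imbalance k m lay j (insert e S)) -
      penalty (imbalance k m lay j S)) ≤ 3 / 16 * (1 / k : ℝ) := by
    calc _ ≤ ∑ j ∈ range t, |levelWeight j (lay e)| * (1 / (8 * k) : ℝ) := by
          refine sum_le_sum fun j _ => ?_
          rw [imbalance_insert _ _ _ _ he]
          refine (le_abs_self _).trans ((abs_penalty_add_sub_le _ _).trans (le_of_eq ?_))
          rw [abs_div, Nat.abs_cast]; ring
      _ = (∑ j ∈ range t, |levelWeight j (lay e)|) * (1 / (8 * k) : ℝ) := by rw [sum_mul]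
      _ ≤ 3 / 2 * (1 / (8 * k) : ℝ) := by
          gcongr; exact sum_abs_levelWeight_le _ _
      _ = _ := by ring
  rw [sum_sub_distrib] at h
  unfold potential
  rw [card_insert_of_notMem he]
  push_cast
  have : ((S.card : ℝ) + 1) / k = S.card / k + 1 / k := by ring
  linarith

lemma potential_second_diff_le (k m : ℕ) (lay : Fin n → ℕ) (t : ℕ)
    {S : Finset (Fin n)} {a b : Fin n} (hab : a ≠ b) (ha : a ∉ S) (hb : b ∉ S) :
    potential k m lay t (insert a (insert b S)) - potential k m lay t (insert b S) -
      (potential k m lay t (insert a S) - potential k m lay t S) ≤ 3 / 16 * (1 / k : ℝ) ^ 2 := by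
  have ha' : a ∉ insert b S := by simp [hab, ha]
  have h : -(3 / 16 * (1 / k : ℝ) ^ 2) ≤
      ∑ j ∈ range t, (penalty (imbalance k m lay j (insert a (insert b S))) -
        penalty (imbalance k m lay j (insert b S)) -
        (penalty (imbalance k m lay j (insert a S)) - penalty (imbalance k m lay j S))) := by
    calc -(3 / 16 * (1 / k : ℝ) ^ 2)
        = 3 / 2 * (-((1 / k : ℝ) ^ 2 / 8)) := by ring
      _ ≤ (∑ j ∈ range t, |levelWeight j (lay a)|) * (-((1 / k : ℝ) ^ 2 / 8)) := by
          refine mul_le_mul_of_nonpos_right (sum_abs_levelWeight_le _ _) ?_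
          rw [neg_nonpos]; positivity
      _ = ∑ j ∈ range t, |levelWeight j (lay a)| * (-((1 / k : ℝ) ^ 2 / 8)) := by rw [sum_mul]
      _ ≤ _ := by
          refine sum_le_sum fun j _ => ?_
          rw [imbalance_insert _ _ _ _ ha', imbalance_insert _ _ _ _ ha,
            imbalance_insert _ _ _ _ hb, add_right_comm]
          refine le_trans ?_ (neg_le_of_abs_le (abs_penalty_second_diff_le _ _ _))
          rw [abs_div, abs_div, Nat.abs_cast, mul_neg, neg_le_neg_iff]
          calc |levelWeight j (lay a)| / k * (|levelWeight j (lay b)| / k) / 8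
              ≤ |levelWeight j (lay a)| / k * (1 / k) / 8 := by
                gcongr; exact abs_levelWeight_le_one _ _
            _ = _ := by ring
  rw [sum_sub_distrib, sum_sub_distrib, sum_sub_distrib] at h
  unfold potential
  rw [card_insert_of_notMem ha', card_insert_of_notMem ha, card_insert_of_notMem hb]
  push_cast
  have h1 : ((S.card : ℝ) + 1 + 1) / k = S.card / k + 1 / k + 1 / k := by ring
  have h2 : ((S.card : ℝ) + 1) / k = S.card / k + 1 / k := by ring
  linarith

/-- Positive second differences of `L` up to the product of the first differences do no harm to
the diminishing returns of `1 - exp (-L)`. -/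
lemma exp_neg_second_diff {p pa pb pab : ℝ} (ha : p ≤ pa) (hb : p ≤ pb)
    (h : pab - pb - (pa - p) ≤ (pa - p) * (pb - p)) :
    Real.exp (-pa) + Real.exp (-pb) ≤ Real.exp (-p) + Real.exp (-pab) := by
  have hab : pab ≤ (pa + pb - p) + (pa - p) * (pb - p) := by linarith
  have e1 : Real.exp (-((pa + pb - p))) * (1 - (pa - p) * (pb - p)) ≤ Real.exp (-pab) := by
    calc _ ≤ Real.exp (-((pa + pb - p))) * Real.exp (-((pa - p) * (pb - p))) := by
          gcongr
          linarith [Real.add_one_le_exp (-((pa - p) * (pb - p)))]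
      _ = Real.exp (-((pa + pb - p)) + -((pa - p) * (pb - p))) := (Real.exp_add _ _).symm
      _ ≤ _ := Real.exp_le_exp.2 (by linarith)
  have e2 : Real.exp (-pa) = Real.exp (-(pa + pb - p)) * Real.exp (pb - p) := by
    rw [← Real.exp_add]; ring_nf
  have e3 : Real.exp (-pb) = Real.exp (-(pa + pb - p)) * Real.exp (pa - p) := by
    rw [← Real.exp_add]; ring_nf
  have e4 : Real.exp (-p) =
      Real.exp (-(pa + pb - p)) * (Real.exp (pa - p) * Real.exp (pb - p)) := by
    rw [← Real.exp_add, ← Real.exp_add]; ring_nf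
  have f1 := Real.add_one_le_exp (pa - p)
  have f2 := Real.add_one_le_exp (pb - p)
  have f3 : (pa - p) * (pb - p) ≤ (Real.exp (pa - p) - 1) * (Real.exp (pb - p) - 1) := by
    apply mul_le_mul <;> linarith
  have f4 := mul_le_mul_of_nonneg_left f3 (Real.exp_pos (-(pa + pb - p))).le
  rw [e2, e3, e4]
  nlinarith

/-- The factor by which `i` elements of the hidden set diminish the residual. The first `m` of them
act like any other elements, afterwards the factor decreases linearly to `0`. -/
noncomputable def hiddenFactor (k m i : ℕ) : ℝ :=
  if i ≤ m then Real.exp (-(i / k : ℝ))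
  else Real.exp (-(m / k : ℝ)) * max 0 (1 - ((i : ℝ) - m) / k)

lemma hiddenFactor_of_le {k m i : ℕ} (h : i ≤ m) :
    hiddenFactor k m i = Real.exp (-(i / k : ℝ)) := if_pos h

lemma hiddenFactor_of_ge {k m i : ℕ} (h : m ≤ i) :
    hiddenFactor k m i = Real.exp (-(m / k : ℝ)) * max 0 (1 - ((i : ℝ) - m) / k) := by
  rcases h.eq_or_lt with rfl | h
  · simp [hiddenFactor]
  · exact if_neg (by omega)

lemma hiddenFactor_nonneg (k m i : ℕ) : 0 ≤ hiddenFactor k m i := by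
  unfold hiddenFactor; split_ifs <;> positivity

lemma hiddenFactor_zero (k m : ℕ) : hiddenFactor k m 0 = 1 := by
  simp [hiddenFactor]

lemma hiddenFactor_succ_le (k m i : ℕ) : hiddenFactor k m (i + 1) ≤ hiddenFactor k m i := by
  rcases lt_or_ge i m with h | h
  · rw [hiddenFactor_of_le h.le, hiddenFactor_of_le h]
    gcongr
    simp
  · rw [hiddenFactor_of_ge h, hiddenFactor_of_ge (by omega)]
    gcongr
    simp

lemma hiddenFactor_convex (k m i : ℕ) :
    hiddenFactor k m (i + 1) - hiddenFactor k m (i + 2) ≤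
      hiddenFactor k m i - hiddenFactor k m (i + 1) := by
  rcases lt_or_ge i m with h | h
  · have e1 : hiddenFactor k m i =
        hiddenFactor k m (i + 1) * Real.exp (1 / k) := by
      rw [hiddenFactor_of_le h.le, hiddenFactor_of_le h, ← Real.exp_add]
      push_cast; ring_nf
    have e2 : hiddenFactor k m (i + 1) * (1 - 1 / k) ≤ hiddenFactor k m (i + 2) := by
      rcases Nat.lt_or_ge (i + 1) m with h' | h'
      · have : hiddenFactor k m (i + 2) = hiddenFactor k m (i + 1) * Real.exp (-(1 / k)) := by
          rw [hiddenFactor_of_le h, hiddenFactor_of_le (by omega), ← Real.exp_add]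
          push_cast; ring_nf
        rw [this]
        gcongr
        · exact hiddenFactor_nonneg _ _ _
        · linarith [Real.add_one_le_exp (-(1 / k : ℝ))]
      · obtain rfl : m = i + 1 := by omega
        rw [hiddenFactor_of_le le_rfl, hiddenFactor_of_ge (by omega)]
        gcongr
        refine le_trans (le_of_eq ?_) (le_max_right _ _)
        push_cast; ring
    have e3 := mul_le_mul_of_nonneg_left (Real.add_one_le_exp (1 / k : ℝ))
      (hiddenFactor_nonneg k m (i + 1))
    nlinarith
  · rw [hiddenFactor_of_ge h, hiddenFactor_of_ge (by omega), hiddenFactor_of_ge (by omega),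
      ← mul_sub, ← mul_sub]
    gcongr ?_ * ?_
    push_cast
    set x : ℝ := ((i : ℝ) - m) / k
    have hx1 : ((i : ℝ) + 1 - m) / k = x + 1 / k := by simp only [x]; ring
    have hx2 : ((i : ℝ) + 2 - m) / k = x + 1 / k + 1 / k := by simp only [x]; ring
    rw [hx1, hx2]
    have hk : (0 : ℝ) ≤ 1 / k := by positivity
    rcases le_total 0 (1 - (x + 1 / k)) with h1 | h1
    · rw [max_eq_right h1, max_eq_right (by linarith : 0 ≤ 1 - x)]
      linarith [le_max_right 0 (1 - (x + 1 / k + 1 / k))]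
    · rw [max_eq_left h1, max_eq_left (by linarith : 1 - (x + 1 / k + 1 / k) ≤ 0)]
      simp

/-- The part of the optimal value that `S` leaves uncovered. Here `Y` is the hidden set. -/
noncomputable def residual (k m l : ℕ) (lay : Fin n → ℕ) (Y S : Finset (Fin n)) : ℝ :=
  Real.exp (-potential k m lay l (S \ Y)) * hiddenFactor k m (S ∩ Y).card

lemma exp_potential_insert_le (k m l : ℕ) (lay : Fin n → ℕ) {S : Finset (Fin n)} {e : Fin n}
    (he : e ∉ S) :
    Real.exp (-potential k m lay l (insert e S)) ≤ Real.exp (-potential k m lay l S) := by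
  have := potential_insert_sub_ge k m lay l he
  have h : (0 : ℝ) ≤ 13 / 16 * (1 / k) := by positivity
  exact Real.exp_le_exp.2 (by linarith)

lemma residual_insert_of_mem {k m l : ℕ} {lay : Fin n → ℕ} {Y S : Finset (Fin n)} {e : Fin n}
    (he : e ∉ S) (hY : e ∈ Y) : residual k m l lay Y (insert e S) =
      Real.exp (-potential k m lay l (S \ Y)) * hiddenFactor k m ((S ∩ Y).card + 1) := by
  unfold residual
  rw [insert_sdiff_of_mem _ hY, insert_inter_of_mem hY,
    card_insert_of_notMem (by simp [he])]

lemma residual_insert_of_notMem {k m l : ℕ} {lay : Fin n → ℕ} {Y S : Finset (Fin n)} {e : Fin n}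
    (hY : e ∉ Y) : residual k m l lay Y (insert e S) =
      Real.exp (-potential k m lay l (insert e (S \ Y))) * hiddenFactor k m (S ∩ Y).card := by
  unfold residual
  rw [insert_sdiff_of_notMem _ hY, insert_inter_of_notMem hY]

lemma residual_insert_le (k m l : ℕ) (lay : Fin n → ℕ) (Y : Finset (Fin n))
    {S : Finset (Fin n)} {e : Fin n} (he : e ∉ S) :
    residual k m l lay Y (insert e S) ≤ residual k m l lay Y S := by
  by_cases hY : e ∈ Y
  · rw [residual_insert_of_mem he hY]
    unfold residual
    gcongr
    exact hiddenFactor_succ_le _ _ _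
  · rw [residual_insert_of_notMem hY]
    unfold residual
    gcongr ?_ * _
    · exact hiddenFactor_nonneg _ _ _
    · exact exp_potential_insert_le _ _ _ _ (by simp [he])

lemma residual_convex (k m l : ℕ) (lay : Fin n → ℕ) (Y : Finset (Fin n))
    {S : Finset (Fin n)} {a b : Fin n} (hab : a ≠ b) (ha : a ∉ S) (hb : b ∉ S) :
    residual k m l lay Y (insert a S) + residual k m l lay Y (insert b S) ≤
      residual k m l lay Y S + residual k m l lay Y (insert a (insert b S)) := by
  have ha' : a ∉ insert b S := by simp [hab, ha]
  have haY : a ∉ S \ Y := by simp [ha]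
  have hbY : b ∉ S \ Y := by simp [hb]
  have hS : residual k m l lay Y S =
      Real.exp (-potential k m lay l (S \ Y)) * hiddenFactor k m (S ∩ Y).card := rfl
  by_cases hYa : a ∈ Y <;> by_cases hYb : b ∈ Y
  · rw [residual_insert_of_mem ha' hYa, insert_sdiff_of_mem _ hYb, insert_inter_of_mem hYb,
      card_insert_of_notMem (by simp [hb]), residual_insert_of_mem ha hYa,
      residual_insert_of_mem hb hYb, hS]
    have h1 := hiddenFactor_convex k m (S ∩ Y).card
    have h2 := (Real.exp_pos (-potential k m lay l (S \ Y))).le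
    nlinarith [mul_le_mul_of_nonneg_left h1 h2]
  · rw [residual_insert_of_mem ha' hYa, insert_sdiff_of_notMem _ hYb,
      insert_inter_of_notMem hYb, residual_insert_of_mem ha hYa,
      residual_insert_of_notMem hYb, hS]
    nlinarith [mul_nonneg (sub_nonneg.2 (hiddenFactor_succ_le k m (S ∩ Y).card))
      (sub_nonneg.2 (exp_potential_insert_le k m l lay hbY))]
  · rw [residual_insert_of_notMem hYa, residual_insert_of_notMem hYa, insert_sdiff_of_mem _ hYb,
      insert_inter_of_mem hYb, card_insert_of_notMem (by simp [hb]), residual_insert_of_mem hb hYb, hS]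
    nlinarith [mul_nonneg (sub_nonneg.2 (hiddenFactor_succ_le k m (S ∩ Y).card))
      (sub_nonneg.2 (exp_potential_insert_le k m l lay haY))]
  · rw [residual_insert_of_notMem hYa, residual_insert_of_notMem hYa,
      insert_sdiff_of_notMem _ hYb, insert_inter_of_notMem hYb,
      residual_insert_of_notMem hYb, hS, ← add_mul, ← add_mul]
    refine mul_le_mul_of_nonneg_right ?_ (hiddenFactor_nonneg _ _ _)
    have h1 := potential_insert_sub_ge k m lay l haY
    have h2 := potential_insert_sub_ge k m lay l hbY
    have hk : (0 : ℝ) ≤ 13 / 16 * (1 / k) := by positivity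
    refine exp_neg_second_diff (by linarith) (by linarith) ?_
    refine (potential_second_diff_le k m lay l hab haY hbY).trans ?_
    refine le_trans ?_ (mul_le_mul h1 h2 hk (hk.trans h1))
    nlinarith [sq_nonneg (1 / k : ℝ)]

/-- The hard function: what the residual leaves, cut off at `1 - τ`. The truncation makes large
queries uninformative. -/
noncomputable def hardFn (k m l : ℕ) (τ : ℝ) (lay : Fin n → ℕ) (Y S : Finset (Fin n)) : ℝ :=
  1 - max (residual k m l lay Y S) τ

lemma monotone_of_insert {f : Finset (Fin n) → ℝ}
    (h : ∀ S e, e ∉ S → f S ≤ f (insert e S)) : Monotone f := by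
  intro S T hST
  obtain ⟨U, rfl⟩ : ∃ U, T = S ∪ U := ⟨T, (union_eq_right.2 hST).symm⟩
  clear hST
  induction U using Finset.induction_on with
  | empty => simp
  | insert b U hb ih =>
    rw [union_insert]
    by_cases hbS : b ∈ S ∪ U
    · rwa [insert_eq_of_mem hbS]
    · exact ih.trans (h _ _ hbS)

/-- Diminishing returns need only be checked for two elements at a time. -/
lemma isSubmodular_of_pairs {f : Finset (Fin n) → ℝ}
    (h : ∀ S a b, a ≠ b → a ∉ S → b ∉ S →
      f S + f (insert a (insert b S)) ≤ f (insert a S) + f (insert b S)) : IsSubmodular f := by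
  intro S T hST e he
  obtain ⟨U, rfl⟩ : ∃ U, T = S ∪ U := ⟨T, (union_eq_right.2 hST).symm⟩
  clear hST
  induction U using Finset.induction_on with
  | empty => simp
  | insert b U hb ih =>
    rw [union_insert] at he ⊢
    have he' : e ∉ S ∪ U := fun h => he (mem_insert_of_mem h)
    refine le_trans ?_ (ih he')
    by_cases hbS : b ∈ S ∪ U
    · rw [insert_eq_of_mem hbS]
    · have := h (S ∪ U) e b (fun h => he (h ▸ mem_insert_self _ _)) he' hbS
      linarith

lemma hardFn_insert_ge (k m l : ℕ) (τ : ℝ) (lay : Fin n → ℕ) (Y : Finset (Fin n))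
    {S : Finset (Fin n)} {e : Fin n} (he : e ∉ S) :
    hardFn k m l τ lay Y S ≤ hardFn k m l τ lay Y (insert e S) := by
  unfold hardFn
  have := residual_insert_le k m l lay Y he
  gcongr

lemma hardFn_monotone (k m l : ℕ) (τ : ℝ) (lay : Fin n → ℕ) (Y : Finset (Fin n)) :
    Monotone (hardFn k m l τ lay Y) :=
  monotone_of_insert fun _ _ he => hardFn_insert_ge k m l τ lay Y he

lemma hardFn_isSubmodular (k m l : ℕ) (τ : ℝ) (lay : Fin n → ℕ) (Y : Finset (Fin n)) :
    IsSubmodular (hardFn k m l τ lay Y) := by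
  refine isSubmodular_of_pairs fun S a b hab ha hb => ?_
  have h := residual_convex k m l lay Y hab ha hb
  have ha' := residual_insert_le k m l lay Y ha
  have hb' := residual_insert_le k m l lay Y hb
  have hab' := residual_insert_le k m l lay Y (S := insert b S) (e := a) (by simp [hab, ha])
  have hba' := residual_insert_le k m l lay Y (S := insert a S) (e := b) (by simp [hab.symm, hb])
  rw [insert_comm] at hba'
  unfold hardFn
  rcases max_cases (residual k m l lay Y S) τ with h1 | h1 <;>
  rcases max_cases (residual k m l lay Y (insert a S)) τ with h2 | h2 <;>
  rcases max_cases (residual k m l lay Y (insert b S)) τ with h3 | h3 <;>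
  rcases max_cases (residual k m l lay Y (insert a (insert b S))) τ with h4 | h4 <;>
  linarith [h1.1, h1.2, h2.1, h2.2, h3.1, h3.2, h4.1, h4.2]

lemma residual_empty (k m l : ℕ) (lay : Fin n → ℕ) (Y : Finset (Fin n)) :
    residual k m l lay Y ∅ = 1 := by
  simp [residual, potential_empty, hiddenFactor_zero]

lemma hardFn_nonneg {k m l : ℕ} {τ : ℝ} (hτ : τ ≤ 1) (lay : Fin n → ℕ) (Y S : Finset (Fin n)) :
    0 ≤ hardFn k m l τ lay Y S := by
  refine le_trans ?_ (hardFn_monotone k m l τ lay Y (empty_subset S))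
  simp [hardFn, residual_empty, hτ]

lemma potential_ge (k m : ℕ) (lay : Fin n → ℕ) (t : ℕ) (S : Finset (Fin n)) :
    13 / 16 * (S.card / k : ℝ) ≤ potential k m lay t S := by
  induction S using Finset.induction_on with
  | empty => simp [potential_empty]
  | insert e S he ih =>
    have := potential_insert_sub_ge k m lay t he
    rw [card_insert_of_notMem he]
    push_cast
    have h : 13 / 16 * (((S.card : ℝ) + 1) / k) = 13 / 16 * (S.card / k) + 13 / 16 * (1 / k) := by
      ring
    linarith

lemma hiddenFactor_le (k m i : ℕ) : hiddenFactor k m i ≤ Real.exp (-(i / k : ℝ)) := by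
  rcases le_total i m with h | h
  · rw [hiddenFactor_of_le h]
  · rw [hiddenFactor_of_ge h]
    calc _ ≤ Real.exp (-(m / k : ℝ)) * Real.exp (-(((i : ℝ) - m) / k)) := by
          gcongr
          refine max_le (Real.exp_pos _).le ?_
          linarith [Real.add_one_le_exp (-(((i : ℝ) - m) / k))]
      _ = _ := by rw [← Real.exp_add]; ring_nf

lemma residual_le_exp (k m l : ℕ) (lay : Fin n → ℕ) (Y S : Finset (Fin n)) :
    residual k m l lay Y S ≤ Real.exp (-(13 / 16 * (S.card / k : ℝ))) := by
  calc _ ≤ Real.exp (-(13 / 16 * ((S \ Y).card / k : ℝ))) *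
        Real.exp (-(((S ∩ Y).card : ℝ) / k)) := by
        unfold residual
        gcongr
        · exact hiddenFactor_nonneg _ _ _
        · exact potential_ge _ _ _ _ _
        · exact hiddenFactor_le _ _ _
    _ ≤ _ := by
        rw [← Real.exp_add, Real.exp_le_exp, ← card_sdiff_add_card_inter S Y]
        push_cast
        have : (0 : ℝ) ≤ (S ∩ Y).card / k := by positivity
        rw [add_div]
        linarith

/-- What remains of the hard function when only the first `t` layers are known: the imbalances of
the other layers, and the hidden set, are ignored. -/
noncomputable def visibleFn (k m t : ℕ) (τ : ℝ) (lay : Fin n → ℕ) (S : Finset (Fin n)) : ℝ :=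
  1 - max (Real.exp (-potential k m lay t S)) τ

lemma levelWeight_min {j t : ℕ} (h : j < t) (i : ℕ) :
    levelWeight j (min i t) = levelWeight j i := by
  unfold levelWeight
  have h1 : min i t = j ↔ i = j := by omega
  have h2 : min i t + 1 = j ↔ i + 1 = j := by omega
  simp only [h1, h2]

lemma visibleFn_congr {k m t : ℕ} {τ : ℝ} {lay lay' : Fin n → ℕ}
    (h : ∀ e, min (lay e) t = min (lay' e) t) (S : Finset (Fin n)) :
    visibleFn k m t τ lay S = visibleFn k m t τ lay' S := by
  have : potential k m lay t S = potential k m lay' t S := by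
    unfold potential imbalance
    congr 1
    refine sum_congr rfl fun j hj => ?_
    congr 3
    refine sum_congr rfl fun e _ => ?_
    rw [← levelWeight_min (mem_range.1 hj), h, levelWeight_min (mem_range.1 hj)]
  rw [visibleFn, visibleFn, this]

lemma hardFn_eq_of_large {k m l : ℕ} {τ : ℝ} (t : ℕ) (lay : Fin n → ℕ) (Y : Finset (Fin n))
    {S : Finset (Fin n)} (h : Real.exp (-(13 / 16 * (S.card / k : ℝ))) ≤ τ) :
    hardFn k m l τ lay Y S = visibleFn k m t τ lay S := by
  unfold hardFn visibleFn
  rw [max_eq_right ((residual_le_exp _ _ _ _ _ _).trans h), max_eq_right (le_trans ?_ h)]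
  have := potential_ge k m lay t S
  exact Real.exp_le_exp.2 (by linarith)

lemma potential_sdiff {k m l : ℕ} {lay : Fin n → ℕ} {Y : Finset (Fin n)} (hY : ∀ e ∈ Y, lay e = l)
    (S : Finset (Fin n)) :
    potential k m lay l (S \ Y) = potential k m lay l S - (S ∩ Y).card / k := by
  have h : ∀ j ∈ range l, imbalance k m lay j (S \ Y) = imbalance k m lay j S := by
    intro j hj
    unfold imbalance
    congr 2
    refine sum_subset sdiff_subset fun e he he' => ?_
    have heY : e ∈ Y := by simpa [he] using he'
    have := mem_range.1 hj
    rw [hY e heY, levelWeight, if_neg (by omega), if_neg (by omega), sub_zero]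
  unfold potential
  rw [sum_congr rfl fun j hj => by rw [h j hj], ← card_sdiff_add_card_inter S Y]
  push_cast
  ring

/-- A set on which the later layers are balanced and which contains few hidden elements does not
reveal the later layers. -/
lemma hardFn_eq_of_balanced {k m l t : ℕ} {τ : ℝ} {lay : Fin n → ℕ} {Y : Finset (Fin n)}
    (hY : ∀ e ∈ Y, lay e = l) (ht : t ≤ l) {S : Finset (Fin n)}
    (hS : ∀ j, t ≤ j → j < l → imbalance k m lay j S ≤ 0) (hSY : (S ∩ Y).card ≤ m) :
    hardFn k m l τ lay Y S = visibleFn k m t τ lay S := by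
  have h : potential k m lay t S = potential k m lay l S := by
    unfold potential
    congr 1
    refine sum_subset (range_subset_range.2 ht) fun j hj hj' => ?_
    rw [mem_range] at hj hj'
    exact penalty_of_nonpos (hS j (by omega) hj)
  unfold hardFn visibleFn residual
  rw [potential_sdiff hY, hiddenFactor_of_le hSY, ← Real.exp_add, h]
  ring_nf

/-! ### Layers of random labels -/

/-- The layer of a label `v < 4 ^ (l + d)`: the labels below `4 ^ (l + d - j)` are those of the
layers `j, …, l`, for all `j ≤ l`. Each layer but the last one is three times as large as all later
layers together. -/
def layer (l d : ℕ) (v : Fin (4 ^ (l + d))) : ℕ :=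
  Nat.findGreatest (fun j => v.val < 4 ^ (l + d - j)) l

lemma layer_le (l d : ℕ) (v : Fin (4 ^ (l + d))) : layer l d v ≤ l := Nat.findGreatest_le l

lemma le_layer_iff {l d j : ℕ} (hj : j ≤ l) (v : Fin (4 ^ (l + d))) :
    j ≤ layer l d v ↔ v.val < 4 ^ (l + d - j) := by
  constructor
  · intro h
    have h0 : v.val < 4 ^ (l + d - layer l d v) :=
      Nat.findGreatest_spec (P := fun j => v.val < 4 ^ (l + d - j)) (Nat.zero_le l)
        (by simp)
    exact h0.trans_le (Nat.pow_le_pow_right (by norm_num) (by omega))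
  · exact fun h => Nat.le_findGreatest hj h

lemma layer_of_val_eq_zero {l d : ℕ} {v : Fin (4 ^ (l + d))} (hv : v.val = 0) :
    layer l d v = l :=
  le_antisymm (layer_le l d v) ((le_layer_iff le_rfl v).2 (by rw [hv]; positivity))

lemma card_le_layer {l d j : ℕ} (hj : j ≤ l) :
    #{v : Fin (4 ^ (l + d)) | j ≤ layer l d v} = 4 ^ (l + d - j) := by
  have h : 4 ^ (l + d - j) ≤ 4 ^ (l + d) := Nat.pow_le_pow_right (by norm_num) (by omega)
  rw [filter_congr fun v _ => le_layer_iff hj v, Fin.card_filter_val_lt, min_eq_right h]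

lemma card_layer_eq {l d j : ℕ} (hj : j < l) :
    #{v : Fin (4 ^ (l + d)) | layer l d v = j} = 3 * 4 ^ (l + d - (j + 1)) := by
  have h : #{v : Fin (4 ^ (l + d)) | j ≤ layer l d v} =
      #{v : Fin (4 ^ (l + d)) | layer l d v = j} +
        #{v : Fin (4 ^ (l + d)) | j + 1 ≤ layer l d v} := by
    rw [← card_union_of_disjoint]
    · congr 1
      ext v
      simp only [mem_union, mem_filter, mem_univ, true_and]
      omega
    · refine disjoint_filter.2 fun v _ h1 h2 => ?_
      omega
  rw [card_le_layer hj.le, card_le_layer (show j + 1 ≤ l from hj),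
    show l + d - j = l + d - (j + 1) + 1 by omega,
    pow_succ] at h
  omega

/-! ### Exponential moments of independent labels -/

/-- Exponential moments of independent labels factorize. -/
lemma sum_prod_piFinset_le {V : Type*} (B : Fin n → Finset V)
    (S : Finset (Fin n)) {g : V → ℝ} (hg : ∀ v, 0 ≤ g v) {C : ℝ}
    (hC : ∀ e, ∑ v ∈ B e, g v ≤ C * #(B e)) :
    ∑ a ∈ Fintype.piFinset B, ∏ e ∈ S, g (a e) ≤ C ^ #S * #(Fintype.piFinset B) := by
  have h1 : ∀ a : Fin n → V, ∏ e ∈ S, g (a e) = ∏ e, if e ∈ S then g (a e) else 1 := by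
    intro a
    rw [prod_ite_mem, univ_inter]
  have h2 : C ^ #S * (#(Fintype.piFinset B) : ℝ) = ∏ e, (if e ∈ S then C else 1) * (#(B e) : ℝ) := by
    rw [prod_mul_distrib, prod_ite_mem, univ_inter, prod_const, Fintype.card_piFinset]
    push_cast
    rfl
  simp_rw [h1]
  rw [h2, ← prod_univ_sum B fun e v => if e ∈ S then g v else 1]
  refine prod_le_prod (fun e _ => sum_nonneg fun v _ => ?_) fun e _ => ?_
  · split_ifs
    exacts [hg v, zero_le_one]
  · split_ifs
    · exact hC e
    · simp

/-- Markov's inequality for the exponential moments. -/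
lemma card_filter_piFinset_le {V : Type*} (B : Fin n → Finset V)
    (S : Finset (Fin n)) {g : V → ℝ} (hg : ∀ v, 0 ≤ g v) {C : ℝ}
    (hC : ∀ e, ∑ v ∈ B e, g v ≤ C * #(B e)) {θ : ℝ} (hθ : 0 < θ) (p : (Fin n → V) → Prop)
    [DecidablePred p] (hp : ∀ a, p a → θ ≤ ∏ e ∈ S, g (a e)) :
    (#{a ∈ Fintype.piFinset B | p a} : ℝ) ≤ C ^ #S / θ * #(Fintype.piFinset B) := by
  rw [div_mul_eq_mul_div, le_div_iff₀ hθ]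
  refine le_trans ?_ (sum_prod_piFinset_le B S hg hC)
  calc (#{a ∈ Fintype.piFinset B | p a} : ℝ) * θ
      = ∑ a ∈ Fintype.piFinset B with p a, θ := by rw [sum_const, nsmul_eq_mul]
    _ ≤ ∑ a ∈ Fintype.piFinset B with p a, ∏ e ∈ S, g (a e) :=
        sum_le_sum fun a ha => hp a (mem_filter.1 ha).2
    _ ≤ _ := sum_le_sum_of_subset_of_nonneg (filter_subset _ _)
        fun a _ _ => prod_nonneg fun e _ => hg _

/-- A labelling of the elements; its labels are independent and uniformly distributed. -/
abbrev Labelling (n l d : ℕ) : Type := Fin n → Fin (4 ^ (l + d))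

/-- The labels that an element may have when its layer, cut off at `t`, is known to be `b`. -/
def labelsAt (l d t b : ℕ) : Finset (Fin (4 ^ (l + d))) := {v | min (layer l d v) t = b}

lemma mem_labelsAt {l d t b : ℕ} {v : Fin (4 ^ (l + d))} :
    v ∈ labelsAt l d t b ↔ min (layer l d v) t = b := by
  simp [labelsAt]

lemma labelsAt_self (l d t : ℕ) : labelsAt l d t t = ({v | t ≤ layer l d v} : Finset _) := by
  simp [labelsAt]

/-- The first `t` layers of a labelling. -/
def firstLayers (l d t : ℕ) (a : Labelling n l d) : Fin n → ℕ := fun e => min (layer l d (a e)) t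

lemma filter_firstLayers_eq (l d t : ℕ) (b : Fin n → ℕ) :
    ({a : Labelling n l d | firstLayers l d t a = b} : Finset _) =
      Fintype.piFinset fun e => labelsAt l d t (b e) := by
  ext a
  simp [firstLayers, labelsAt, funext_iff]

/-- The number of elements of `S` in layer `j`. -/
def layerCount (l d : ℕ) (a : Labelling n l d) (j : ℕ) (S : Finset (Fin n)) : ℕ :=
  #{e ∈ S | layer l d (a e) = j}

/-- The hidden set: the elements of label `0`, which lies in the last layer. -/
def hiddenSet (l d : ℕ) (a : Labelling n l d) : Finset (Fin n) := {e | (a e).val = 0}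

lemma prod_ite_one (S : Finset (Fin n)) (p : Fin n → Prop) [DecidablePred p] (x : ℝ) :
    ∏ e ∈ S, (if p e then x else 1) = x ^ #{e ∈ S | p e} := by
  rw [prod_ite, prod_const, prod_const_one, mul_one]

lemma sum_levelWeight (l d : ℕ) (a : Labelling n l d) (j : ℕ) (S : Finset (Fin n)) :
    ∑ e ∈ S, levelWeight (j + 1) (layer l d (a e)) =
      (layerCount l d a (j + 1) S : ℝ) - layerCount l d a j S / 2 := by
  unfold levelWeight layerCount
  simp only [add_left_inj]
  rw [sum_sub_distrib, sum_boole, ← sum_filter, sum_const, nsmul_eq_mul]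
  ring

/-- A later layer `j + 1` is unlikely to contain much more than half as many elements of a fixed
set as layer `j`. -/
lemma card_imbalanced_le {l d t j : ℕ} (htj : t ≤ j) (hj : j + 1 < l) (m : ℕ) (b : Fin n → ℕ)
    (S : Finset (Fin n)) :
    (#{a ∈ Fintype.piFinset fun e => labelsAt l d t (b e) |
        layerCount l d a j S + 2 * m < 2 * layerCount l d a (j + 1) S} : ℝ) ≤
      1 / 2 ^ m * #(Fintype.piFinset fun e => labelsAt l d t (b e)) := by
  -- Layer `j` has four times as many labels as layer `j + 1`, so the mean of the weights is at most
  -- `1`; and `9 / 4` is the inverse square of `2 / 3`, so the product is at least `(9 / 4) ^ m`.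
  have key := card_filter_piFinset_le (fun e => labelsAt l d t (b e)) S
    (g := fun v => (if layer l d v = j + 1 then 9 / 4 else 1) * (if layer l d v = j then 2 / 3 else 1))
    (fun v => by positivity) (C := 1) ?_ (θ := 2 ^ m) (by positivity)
    (fun a => layerCount l d a j S + 2 * m < 2 * layerCount l d a (j + 1) S) ?_
  · rwa [one_pow] at key
  · intro e
    rw [one_mul]
    by_cases hb : b e = t
    · have hg : ∀ v, (if layer l d v = j + 1 then (9 / 4 : ℝ) else 1) *
          (if layer l d v = j then 2 / 3 else 1) =
          1 + 5 / 4 * (if layer l d v = j + 1 then 1 else 0) -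
            1 / 3 * (if layer l d v = j then 1 else 0) := by
        intro v
        split_ifs <;> first | omega | norm_num
      have hsub : ∀ i, t ≤ i → ({v ∈ labelsAt l d t t | layer l d v = i} : Finset _) =
          ({v | layer l d v = i} : Finset _) := by
        intro i hi
        rw [labelsAt_self, filter_filter]
        exact filter_congr fun v _ => by omega
      simp_rw [hg]
      rw [hb, sum_sub_distrib, sum_add_distrib, ← mul_sum, ← mul_sum, sum_boole, sum_boole,
        hsub _ htj, hsub _ (by omega), card_layer_eq hj, card_layer_eq (by omega), sum_const,
        nsmul_eq_mul, show l + d - (j + 1) = l + d - (j + 1 + 1) + 1 by omega, pow_succ]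
      push_cast
      have : (0 : ℝ) < 4 ^ (l + d - (j + 1 + 1)) := by positivity
      linarith
    · rw [sum_congr rfl (g := fun _ => (1 : ℝ))]
      · simp
      · intro v hv
        rw [mem_labelsAt] at hv
        rw [if_neg (by omega), if_neg (by omega), mul_one]
  · intro a ha
    rw [prod_mul_distrib, prod_ite_one S (fun e => layer l d (a e) = j + 1),
      prod_ite_one S (fun e => layer l d (a e) = j)]
    change _ ≤ (9 / 4 : ℝ) ^ layerCount l d a (j + 1) S * (2 / 3) ^ layerCount l d a j S
    calc (2 : ℝ) ^ m ≤ (9 / 4) ^ m := by gcongr; norm_num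
      _ = (3 / 2) ^ (layerCount l d a j S + 2 * m) * (2 / 3) ^ layerCount l d a j S := by
          rw [pow_add, mul_right_comm, ← mul_pow, pow_mul]; norm_num
      _ ≤ (3 / 2) ^ (2 * layerCount l d a (j + 1) S) * (2 / 3) ^ layerCount l d a j S := by
          gcongr
          norm_num
      _ = _ := by rw [pow_mul]; norm_num

/-- All layers after `t` together are unlikely to contain many more elements of a fixed set than
layer `t`. -/
lemma card_tailHeavy_le {l d t : ℕ} (ht : t < l) (m : ℕ) (b : Fin n → ℕ) (S : Finset (Fin n)) :
    (#{a ∈ Fintype.piFinset fun e => labelsAt l d t (b e) |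
        layerCount l d a t S + m < #{e ∈ S | t < layer l d (a e)}} : ℝ) ≤
      1 / 2 ^ m * #(Fintype.piFinset fun e => labelsAt l d t (b e)) := by
  have key := card_filter_piFinset_le (fun e => labelsAt l d t (b e)) S
    (g := fun v => (if layer l d v = t then 1 / 2 else 1) * (if t < layer l d v then 2 else 1))
    (fun v => by positivity) (C := 1) ?_ (θ := 2 ^ m) (by positivity)
    (fun a => layerCount l d a t S + m < #{e ∈ S | t < layer l d (a e)}) ?_
  · rwa [one_pow] at key
  · intro e
    rw [one_mul]
    by_cases hb : b e = t
    · have hg : ∀ v, (if layer l d v = t then (1 / 2 : ℝ) else 1) *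
          (if t < layer l d v then 2 else 1) =
          1 - 1 / 2 * (if layer l d v = t then 1 else 0) +
            (if t + 1 ≤ layer l d v then 1 else 0) := by
        intro v
        split_ifs <;> first | omega | norm_num
      have hsub1 : ({v ∈ labelsAt l d t t | layer l d v = t} : Finset _) =
          ({v | layer l d v = t} : Finset _) := by
        rw [labelsAt_self, filter_filter]
        exact filter_congr fun v _ => by omega
      have hsub2 : ({v ∈ labelsAt l d t t | t + 1 ≤ layer l d v} : Finset _) =
          ({v | t + 1 ≤ layer l d v} : Finset _) := by
        rw [labelsAt_self, filter_filter]
        exact filter_congr fun v _ => by omega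
      simp_rw [hg]
      rw [hb, sum_add_distrib, sum_sub_distrib, ← mul_sum, sum_boole, sum_boole,
        hsub1, hsub2, card_layer_eq ht, card_le_layer (by omega), sum_const, nsmul_eq_mul]
      push_cast
      have : (0 : ℝ) < 4 ^ (l + d - (t + 1)) := by positivity
      linarith
    · rw [sum_congr rfl (g := fun _ => (1 : ℝ))]
      · simp
      · intro v hv
        rw [mem_labelsAt] at hv
        rw [if_neg (by omega), if_neg (by omega), mul_one]
  · intro a ha
    rw [prod_mul_distrib, prod_ite_one S (fun e => layer l d (a e) = t),
      prod_ite_one S (fun e => t < layer l d (a e))]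
    change _ ≤ (1 / 2 : ℝ) ^ layerCount l d a t S * _
    calc (2 : ℝ) ^ m = (1 / 2) ^ layerCount l d a t S * 2 ^ (layerCount l d a t S + m) := by
          rw [pow_add, ← mul_assoc, ← mul_pow]; norm_num
      _ ≤ _ := by
          gcongr
          norm_num

/-- A fixed set that is not too large is unlikely to contain many hidden elements. -/
lemma card_hiddenHeavy_le {l d t : ℕ} (ht : t ≤ l) (m : ℕ) (b : Fin n → ℕ) {S : Finset (Fin n)}
    (hS : #S ≤ 4 ^ d) :
    (#{a ∈ Fintype.piFinset fun e => labelsAt l d t (b e) | m < #(S ∩ hiddenSet l d a)} : ℝ) ≤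
      3 / 2 ^ m * #(Fintype.piFinset fun e => labelsAt l d t (b e)) := by
  have key := card_filter_piFinset_le (fun e => labelsAt l d t (b e)) S
    (g := fun v => if v.val = 0 then 2 else 1)
    (fun v => by positivity) (C := 1 + 1 / 4 ^ d) ?_ (θ := 2 ^ m) (by positivity)
    (fun a => m < #(S ∩ hiddenSet l d a)) ?_
  · refine key.trans ?_
    gcongr
    calc (1 + 1 / 4 ^ d : ℝ) ^ #S ≤ Real.exp (1 / 4 ^ d) ^ #S := by
          gcongr
          linarith [Real.add_one_le_exp (1 / 4 ^ d : ℝ)]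
      _ = Real.exp (#S * (1 / 4 ^ d)) := (Real.exp_nat_mul _ _).symm
      _ ≤ Real.exp 1 := by
          refine Real.exp_le_exp.2 ?_
          rw [mul_one_div, div_le_one (by positivity)]
          exact_mod_cast hS
      _ ≤ 3 := Real.exp_one_lt_three.le
  · intro e
    have hg : ∀ v : Fin (4 ^ (l + d)), (if v.val = 0 then (2 : ℝ) else 1) =
        1 + (if v.val = 0 then 1 else 0) := by
      intro v
      split_ifs <;> norm_num
    simp_rw [hg]
    rw [sum_add_distrib, sum_boole, sum_const, nsmul_eq_mul, mul_one, add_mul, one_mul]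
    gcongr
    by_cases hb : b e = t
    · have h1 : #{v ∈ labelsAt l d t (b e) | v.val = 0} ≤ 1 :=
        card_le_one.2 fun v hv w hw => Fin.ext <| by
          rw [(mem_filter.1 hv).2, (mem_filter.1 hw).2]
      have h2 : 4 ^ d ≤ #(labelsAt l d t (b e)) := by
        rw [hb, labelsAt_self, card_le_layer ht]
        exact Nat.pow_le_pow_right (by norm_num) (by omega)
      have h3 : (4 : ℝ) ^ d ≤ #(labelsAt l d t (b e)) := by exact_mod_cast h2
      calc (#{v ∈ labelsAt l d t (b e) | v.val = 0} : ℝ) ≤ 1 := by exact_mod_cast h1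
        _ = 1 / 4 ^ d * 4 ^ d := by field_simp
        _ ≤ _ := by gcongr
    · have h1 : #{v ∈ labelsAt l d t (b e) | v.val = 0} = 0 := by
        rw [card_eq_zero, filter_eq_empty_iff]
        intro v hv h0
        rw [mem_labelsAt, layer_of_val_eq_zero h0, min_eq_right ht] at hv
        exact hb hv.symm
      rw [h1, Nat.cast_zero]
      positivity
  · intro a ha
    rw [prod_ite_one S (fun e => (a e).val = 0)]
    have : S ∩ hiddenSet l d a = {e ∈ S | (a e).val = 0} := by
      ext e; simp [hiddenSet]
    rw [← this]
    gcongr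
    norm_num

/-- The hidden set is unlikely to have fewer than `k` elements. -/
lemma card_hiddenSet_lt_le {l d k : ℕ} (h : 4 * k * 4 ^ (l + d) ≤ n) :
    (#{a : Labelling n l d | #(hiddenSet l d a) < k} : ℝ) ≤
      1 / 2 ^ k * Fintype.card (Labelling n l d) := by
  have hN : (0 : ℝ) < 4 ^ (l + d) := by positivity
  have hN1 : (1 : ℝ) ≤ 4 ^ (l + d) := one_le_pow₀ (by norm_num)
  have hC0 : (0 : ℝ) ≤ 1 - 1 / (2 * 4 ^ (l + d)) := by
    rw [sub_nonneg, div_le_one (by positivity)]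
    linarith
  have key := card_filter_piFinset_le (n := n) (fun _ => (univ : Finset (Fin (4 ^ (l + d))))) univ
    (g := fun v => if v.val = 0 then 1 / 2 else 1)
    (fun v => by positivity) (C := 1 - 1 / (2 * 4 ^ (l + d))) ?_ (θ := (1 / 2) ^ k) (by positivity)
    (fun a => #(hiddenSet l d a) < k) ?_
  · simp only [Fintype.piFinset_univ, card_univ, Fintype.card_fin] at key
    refine key.trans (mul_le_mul_of_nonneg_right ?_ (Nat.cast_nonneg _))
    rw [div_le_iff₀ (by positivity)]
    calc (1 - 1 / (2 * 4 ^ (l + d)) : ℝ) ^ n ≤ Real.exp (-(1 / (2 * 4 ^ (l + d)))) ^ n := by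
          gcongr
          linarith [Real.add_one_le_exp (-(1 / (2 * 4 ^ (l + d)) : ℝ))]
      _ = Real.exp (n * -(1 / (2 * 4 ^ (l + d)))) := (Real.exp_nat_mul _ _).symm
      _ ≤ Real.exp (k * -2) := by
          refine Real.exp_le_exp.2 ?_
          have h' : (4 * k * 4 ^ (l + d) : ℝ) ≤ n := by exact_mod_cast h
          rw [mul_neg, mul_neg, neg_le_neg_iff, mul_one_div, le_div_iff₀ (by positivity)]
          linarith
      _ = Real.exp (-2) ^ k := Real.exp_nat_mul _ _
      _ ≤ (1 / 4) ^ k := by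
          gcongr
          rw [Real.exp_neg, one_div]
          gcongr
          have := Real.exp_one_gt_d9
          rw [show (2 : ℝ) = 1 + 1 by norm_num, Real.exp_add]
          nlinarith
      _ = 1 / 2 ^ k * (1 / 2) ^ k := by
          rw [← one_div_pow, ← mul_pow]; norm_num
  · intro e
    have hg : ∀ v : Fin (4 ^ (l + d)), (if v.val = 0 then (1 / 2 : ℝ) else 1) =
        1 - 1 / 2 * (if v.val = 0 then 1 else 0) := by
      intro v
      split_ifs <;> norm_num
    have h0 : #{v : Fin (4 ^ (l + d)) | v.val = 0} = 1 :=
      card_eq_one.2 ⟨⟨0, by positivity⟩, by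
        ext v
        simp only [mem_filter, mem_univ, true_and, mem_singleton, Fin.ext_iff]⟩
    simp_rw [hg]
    rw [sum_sub_distrib, ← mul_sum, sum_boole, h0, sum_const, nsmul_eq_mul, card_univ,
      Fintype.card_fin]
    push_cast
    refine le_of_eq ?_
    field_simp
  · intro a ha
    rw [prod_ite_one univ (fun e => (a e).val = 0)]
    exact pow_le_pow_of_le_one (by norm_num) (by norm_num) ha.le

/-! ### Unbalanced sets are rare -/

/-- The set `S` may reveal something about the layers after `t`: one of them is imbalanced, or `S`
contains many hidden elements, or many more elements of the layers after `t` than of layer `t`. -/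
def Unbalanced (m l d t : ℕ) (a : Labelling n l d) (S : Finset (Fin n)) : Prop :=
  (∃ j < l, t ≤ j ∧ j + 1 < l ∧ layerCount l d a j S + 2 * m < 2 * layerCount l d a (j + 1) S) ∨
  (#S ≤ 4 ^ d ∧ m < #(S ∩ hiddenSet l d a)) ∨
  layerCount l d a t S + m < #{e ∈ S | t < layer l d (a e)}

open Classical in
lemma card_unbalanced_le {l d t : ℕ} (ht : t < l) (m : ℕ) (b : Fin n → ℕ) (S : Finset (Fin n)) :
    (#{a : Labelling n l d | firstLayers l d t a = b ∧ Unbalanced m l d t a S} : ℝ) ≤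
      (l + 4) / 2 ^ m * #{a : Labelling n l d | firstLayers l d t a = b} := by
  rw [← filter_filter, filter_firstLayers_eq]
  set F := Fintype.piFinset fun e => labelsAt l d t (b e)
  have hsub : ({a ∈ F | Unbalanced m l d t a S} : Finset _) ⊆
      ((range l).biUnion fun j => {a ∈ F | (t ≤ j ∧ j + 1 < l) ∧
        layerCount l d a j S + 2 * m < 2 * layerCount l d a (j + 1) S}) ∪
      ({a ∈ F | #S ≤ 4 ^ d ∧ m < #(S ∩ hiddenSet l d a)} ∪
        {a ∈ F | layerCount l d a t S + m < #{e ∈ S | t < layer l d (a e)}}) := by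
    intro a ha
    rw [mem_filter] at ha
    simp only [mem_union, mem_biUnion, mem_filter, mem_range]
    rcases ha.2 with ⟨j, hj, h1, h2, h3⟩ | h | h
    · exact Or.inl ⟨j, hj, ha.1, ⟨h1, h2⟩, h3⟩
    · exact Or.inr (Or.inl ⟨ha.1, h⟩)
    · exact Or.inr (Or.inr ⟨ha.1, h⟩)
  have h1 : ((∑ j ∈ range l, #{a ∈ F | (t ≤ j ∧ j + 1 < l) ∧
      layerCount l d a j S + 2 * m < 2 * layerCount l d a (j + 1) S} : ℕ) : ℝ) ≤
      l * (1 / 2 ^ m * #F) := by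
    push_cast
    refine le_trans (sum_le_sum (g := fun _ => 1 / 2 ^ m * (#F : ℝ)) fun j _ => ?_)
      (by rw [sum_const, card_range, nsmul_eq_mul])
    by_cases hj : t ≤ j ∧ j + 1 < l
    · simp only [hj, true_and]
      convert card_imbalanced_le (d := d) hj.1 hj.2 m b S
    · simp only [hj, false_and, filter_false, card_empty, Nat.cast_zero]
      positivity
  have h2 : (#{a ∈ F | #S ≤ 4 ^ d ∧ m < #(S ∩ hiddenSet l d a)} : ℝ) ≤ 3 / 2 ^ m * #F := by
    by_cases hS : #S ≤ 4 ^ d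
    · simp only [hS, true_and]
      exact card_hiddenHeavy_le ht.le m b hS
    · simp only [hS, false_and, filter_false, card_empty, Nat.cast_zero]
      positivity
  have h3 := card_tailHeavy_le (d := d) ht m b S
  have h4 := (card_le_card hsub).trans ((card_union_le _ _).trans
    (add_le_add card_biUnion_le (card_union_le _ _)))
  have h5 : (#{a ∈ F | Unbalanced m l d t a S} : ℝ) ≤ l * (1 / 2 ^ m * #F) +
      (3 / 2 ^ m * #F + 1 / 2 ^ m * #F) := by
    refine (Nat.cast_le.2 h4).trans ?_
    rw [Nat.cast_add, Nat.cast_add]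
    exact add_le_add h1 (add_le_add h2 h3)
  refine h5.trans (le_of_eq ?_)
  ring

open Classical in
/-- A union bound for adaptively chosen sets: if an event is unlikely for each fixed set even when
the information `τ` is given, it is unlikely for all of the sets chosen on the basis of `τ`. -/
lemma card_exists_mem_le {ι β : Type*} [Fintype ι] [DecidableEq β] (τ : ι → β)
    (Ev : ι → Finset (Fin n) → Prop) {δ : ℝ} (hδ : 0 ≤ δ)
    (h : ∀ b S, (#{a | τ a = b ∧ Ev a S} : ℝ) ≤ δ * #{a | τ a = b})
    (Q : ι → List (Finset (Fin n))) (hQ : ∀ a a', τ a = τ a' → Q a = Q a') {q : ℕ}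
    (hq : ∀ a, (Q a).length ≤ q) :
    (#{a | ∃ S ∈ Q a, Ev a S} : ℝ) ≤ q * δ * Fintype.card ι := by
  have hfib : ∀ b, (#{a ∈ ({a | ∃ S ∈ Q a, Ev a S} : Finset ι) | τ a = b} : ℝ) ≤
      q * δ * #{a | τ a = b} := by
    intro b
    rcases ({a | τ a = b} : Finset ι).eq_empty_or_nonempty with he | ⟨a₀, ha₀⟩
    · rw [filter_comm, he]
      simp
    · have hτ : τ a₀ = b := (mem_filter.1 ha₀).2
      have hsub : ({a ∈ ({a | ∃ S ∈ Q a, Ev a S} : Finset ι) | τ a = b}) ⊆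
          (Q a₀).toFinset.biUnion fun S => {a | τ a = b ∧ Ev a S} := by
        intro a ha
        simp only [mem_filter, mem_univ, true_and] at ha
        obtain ⟨⟨S, hS, hE⟩, hb⟩ := ha
        rw [hQ a a₀ (hb.trans hτ.symm)] at hS
        simp only [mem_biUnion, List.mem_toFinset, mem_filter, mem_univ, true_and]
        exact ⟨S, hS, hb, hE⟩
      calc (#{a ∈ ({a | ∃ S ∈ Q a, Ev a S} : Finset ι) | τ a = b} : ℝ)
          ≤ ((∑ S ∈ (Q a₀).toFinset, #{a | τ a = b ∧ Ev a S} : ℕ) : ℝ) :=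
            Nat.cast_le.2 ((card_le_card hsub).trans card_biUnion_le)
        _ ≤ ∑ S ∈ (Q a₀).toFinset, δ * #{a | τ a = b} := by
            push_cast
            exact sum_le_sum fun S _ => h b S
        _ = #(Q a₀).toFinset * (δ * #{a | τ a = b}) := by rw [sum_const, nsmul_eq_mul]
        _ ≤ q * (δ * #{a | τ a = b}) := by
            gcongr
            exact (List.toFinset_card_le _).trans (hq a₀)
        _ = _ := by ring
  rw [card_eq_sum_card_fiberwise (f := τ) (t := univ.image τ) (fun a _ => by simp),
    ← card_univ, card_eq_sum_card_image τ univ]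
  push_cast
  rw [mul_sum]
  exact sum_le_sum fun b _ => hfib b

/-! ### Simulating an algorithm with partial information -/

/-- The history of an algorithm when the queries of round `t` are answered by `v t`. -/
def simHistory {k q : ℕ} (A : AdaptiveAlgorithm n k q) (v : ℕ → Finset (Fin n) → ℝ) :
    ℕ → QueryHistory n
  | 0 => []
  | t + 1 => simHistory A v t ++ [(A.queries (simHistory A v t)).map fun S => (S, v t S)]

lemma simHistory_congr {k q : ℕ} (A : AdaptiveAlgorithm n k q) {v v' : ℕ → Finset (Fin n) → ℝ}
    {t : ℕ} (h : ∀ s < t, v s = v' s) : simHistory A v t = simHistory A v' t := by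
  induction t with
  | zero => rfl
  | succ t ih => rw [simHistory, simHistory, ih fun s hs => h s (by omega), h t (by omega)]

lemma history_eq_simHistory {k q : ℕ} (A : AdaptiveAlgorithm n k q) {f : Finset (Fin n) → ℝ}
    {v : ℕ → Finset (Fin n) → ℝ} {r : ℕ}
    (h : ∀ t < r, ∀ S ∈ A.queries (simHistory A v t), f S = v t S) :
    A.history f r = simHistory A v r := by
  induction r with
  | zero => rfl
  | succ r ih =>
    rw [AdaptiveAlgorithm.history, simHistory, ih fun t ht => h t (by omega)]
    congr 2
    refine List.map_congr_left fun S hS => ?_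
    rw [h r (by omega) S hS]

/-! ### The value of balanced sets and the optimum -/

/-- The truncation level: sets of more than `4 ^ d` elements reach it. -/
noncomputable def cutoff (k d : ℕ) : ℝ := Real.exp (-(13 / 16 * ((4 : ℝ) ^ d / k)))

/-- The hard function of a labelling. -/
noncomputable def labelFn (k m l d : ℕ) (a : Labelling n l d) : Finset (Fin n) → ℝ :=
  hardFn k m l (cutoff k d) (fun e => layer l d (a e)) (hiddenSet l d a)

/-- The function of which round `t` of an algorithm learns the values (rounds are counted from `0`):
it depends only on the first `t + 1` layers. -/
noncomputable def roundFn (k m l d : ℕ) (a : Labelling n l d) (t : ℕ) : Finset (Fin n) → ℝ :=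
  visibleFn k m (t + 1) (cutoff k d) (fun e => layer l d (a e))

lemma labelFn_eq_roundFn {k m l d t : ℕ} (ht : t < l) {a : Labelling n l d}
    {S : Finset (Fin n)} (h : ¬ Unbalanced m l d t a S) :
    labelFn k m l d a S = roundFn k m l d a t S := by
  unfold Unbalanced at h
  push Not at h
  obtain ⟨h1, h2, -⟩ := h
  -- On large sets both functions are truncated.
  rcases le_total (#S) (4 ^ d) with hS | hS
  · refine hardFn_eq_of_balanced (fun e he => ?_) ht (fun j hj hjl => ?_) (h2 hS)
    · exact layer_of_val_eq_zero (mem_filter.1 he).2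
    · obtain ⟨i, rfl⟩ : ∃ i, j = i + 1 := ⟨j - 1, by omega⟩
      have h3 := h1 i (by omega) (by omega) hjl
      refine div_nonpos_of_nonpos_of_nonneg ?_ (Nat.cast_nonneg _)
      rw [sum_levelWeight]
      have h4 : (2 * layerCount l d a (i + 1) S : ℝ) ≤ layerCount l d a i S + 2 * m := by
        exact_mod_cast h3
      linarith
  · refine hardFn_eq_of_large _ _ _ (Real.exp_le_exp.2 ?_)
    have : ((4 : ℝ) ^ d) ≤ #S := by exact_mod_cast hS
    gcongr

lemma roundFn_congr {k m l d s t : ℕ} (hst : s < t) {a a' : Labelling n l d}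
    (h : firstLayers l d t a = firstLayers l d t a') :
    roundFn k m l d a s = roundFn k m l d a' s := by
  funext S
  refine visibleFn_congr (fun e => ?_) S
  have := congrFun h e
  unfold firstLayers at this
  omega

lemma sum_range_levelWeight_ge (t i : ℕ) :
    (if i < t then 1 / 2 else 0 : ℝ) ≤ ∑ j ∈ range t, levelWeight j i := by
  unfold levelWeight
  rw [sum_sub_distrib, sum_ite_eq, sum_ite_eq]
  simp only [mem_range]
  split_ifs <;> first | omega | norm_num

/-- A set of at most `k` elements that is balanced after layer `r` pays a penalty of order `1 / r`:
at least a constant fraction of it lies in the first `r + 1` layers, and spreading it evenly over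
them is the best choice. -/
lemma potential_le_of_balanced {k m l d r : ℕ} (hr : 1 ≤ r) (hk : 0 < k)
    (hm : ((r : ℝ) + 2) * (m / k) ≤ 1 / 40) {a : Labelling n l d} {S : Finset (Fin n)}
    (hS : #S ≤ k) (h : #{e ∈ S | r < layer l d (a e)} ≤ layerCount l d a r S + m) :
    potential k m (fun e => layer l d (a e)) (r + 1) S ≤ 1 - 1 / (3200 * r) := by
  have hr' : (1 : ℝ) ≤ r := by exact_mod_cast hr
  have hk' : (0 : ℝ) < k := by exact_mod_cast hk
  have hx1 : (#S : ℝ) / k ≤ 1 := by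
    rw [div_le_one hk']; exact_mod_cast hS
  set z : ℕ → ℝ := fun j => imbalance k m (fun e => layer l d (a e)) j S with hz
  have hpot : potential k m (fun e => layer l d (a e)) (r + 1) S =
    #S / k - ∑ j ∈ range (r + 1), penalty (z j) := rfl
  rcases le_total ((#S : ℝ) / k) (1 / 2) with hx | hx
  · have h1 : 0 ≤ ∑ j ∈ range (r + 1), penalty (z j) := sum_nonneg fun j _ => penalty_nonneg _
    have h2 : 1 / (3200 * r : ℝ) ≤ 1 / 2 := by
      rw [div_le_div_iff₀ (by positivity) (by norm_num)]; linarith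
    linarith
  · have hz1 : ∀ j, z j ≤ 1 := by
      intro j
      rw [hz]
      simp only [imbalance]
      rw [div_le_one hk']
      have h1 : ∑ e ∈ S, levelWeight j (layer l d (a e)) ≤ ∑ e ∈ S, 1 :=
        sum_le_sum fun e _ => (le_abs_self _).trans (abs_levelWeight_le_one _ _)
      rw [sum_const, nsmul_eq_mul, mul_one] at h1
      have h2 : (#S : ℝ) ≤ k := by exact_mod_cast hS
      have h3 : (0 : ℝ) ≤ m := Nat.cast_nonneg _
      linarith
    have hsum : 1 / 10 ≤ ∑ j ∈ range (r + 1), z j := by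
      have h1 : ∑ j ∈ range (r + 1), z j =
          (∑ e ∈ S, ∑ j ∈ range (r + 1), levelWeight j (layer l d (a e)) - (r + 1) * m) / k := by
        simp only [hz, imbalance]
        rw [← sum_div, sum_sub_distrib, sum_comm]
        simp
      have h2 : (#{e ∈ S | layer l d (a e) < r + 1} : ℝ) / 2 ≤
          ∑ e ∈ S, ∑ j ∈ range (r + 1), levelWeight j (layer l d (a e)) := by
        refine le_trans (le_of_eq ?_) (sum_le_sum fun e _ => sum_range_levelWeight_ge (r + 1) _)
        rw [← sum_filter, sum_const, nsmul_eq_mul]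
        ring
      have h3 : #S = #{e ∈ S | layer l d (a e) < r + 1} + #{e ∈ S | r < layer l d (a e)} := by
        rw [← card_filter_add_card_filter_not (s := S) fun e => layer l d (a e) < r + 1]
        congr 2
        exact filter_congr fun e _ => by omega
      have h4 : layerCount l d a r S ≤ #{e ∈ S | layer l d (a e) < r + 1} := by
        refine card_le_card fun e he => ?_
        rw [mem_filter] at he ⊢
        exact ⟨he.1, by omega⟩
      have h5 : (#S : ℝ) ≤ 2 * #{e ∈ S | layer l d (a e) < r + 1} + m := by
        have : #S ≤ 2 * #{e ∈ S | layer l d (a e) < r + 1} + m := by omega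
        exact_mod_cast this
      have h6 : ((#S : ℝ) / 4 - (r + 2) * m) / k ≤ ∑ j ∈ range (r + 1), z j := by
        rw [h1]
        refine div_le_div_of_nonneg_right ?_ hk'.le
        have h7 : (0 : ℝ) ≤ m := Nat.cast_nonneg _
        linarith
      have h8 : ((#S : ℝ) / 4 - (r + 2) * m) / k = (#S / k) / 4 - (r + 2) * (m / k) := by ring
      linarith
    have hpen : 1 / (3200 * r : ℝ) ≤ ∑ j ∈ range (r + 1), penalty (z j) := by
      -- the tangent at the lower bound for the average imbalance
      set s : ℝ := 1 / (10 * (r + 1)) with hs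
      have hs0 : 0 ≤ s := by positivity
      calc (1 / (3200 * r) : ℝ) ≤ 1 / (1600 * (r + 1)) := by
            rw [div_le_div_iff₀ (by positivity) (by positivity)]; linarith
        _ = s * (1 / 10) / 8 - (r + 1) * (s ^ 2 / 16) := by
            rw [hs]; field_simp; norm_num
        _ ≤ s * (∑ j ∈ range (r + 1), z j) / 8 - (r + 1) * (s ^ 2 / 16) := by gcongr
        _ = ∑ j ∈ range (r + 1), (s * z j / 8 - s ^ 2 / 16) := by
            rw [sum_sub_distrib, ← sum_div, ← mul_sum]
            simp
        _ ≤ _ := sum_le_sum fun j _ => tangent_le_penalty hs0 (hz1 j)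
    linarith

lemma labelFn_le_of_balanced {k m l d r : ℕ} (hr : 1 ≤ r) (hrl : r < l) (hk : 0 < k)
    (hm : ((r : ℝ) + 2) * (m / k) ≤ 1 / 40) {a : Labelling n l d} {S : Finset (Fin n)}
    (hS : #S ≤ k) (h : ¬ Unbalanced m l d r a S) :
    labelFn k m l d a S ≤ 1 - 1 / Real.exp 1 - 1 / (9600 * r) := by
  rw [labelFn_eq_roundFn hrl h]
  unfold Unbalanced at h
  push Not at h
  have hpot := potential_le_of_balanced hr hk hm hS h.2.2
  have hr' : (1 : ℝ) ≤ r := by exact_mod_cast hr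
  set x : ℝ := 1 / (3200 * r) with hx
  have hx0 : 0 ≤ x := by positivity
  have h1 : 1 / Real.exp 1 + x / 3 ≤
      Real.exp (-potential k m (fun e => layer l d (a e)) (r + 1) S) := by
    have h3 : (1 : ℝ) / 3 ≤ 1 / Real.exp 1 :=
      one_div_le_one_div_of_le (Real.exp_pos _) Real.exp_one_lt_three.le
    calc 1 / Real.exp 1 + x / 3 ≤ 1 / Real.exp 1 * (x + 1) := by nlinarith
      _ ≤ 1 / Real.exp 1 * Real.exp x := by
          gcongr; exact Real.add_one_le_exp x
      _ = Real.exp (-(1 - x)) := by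
          rw [one_div, ← Real.exp_neg, ← Real.exp_add]; ring_nf
      _ ≤ _ := Real.exp_le_exp.2 (by linarith)
  have h2 : x / 3 = 1 / (9600 * r) := by rw [hx]; field_simp; norm_num
  unfold roundFn visibleFn
  have := le_max_left (Real.exp (-potential k m (fun e => layer l d (a e)) (r + 1) S)) (cutoff k d)
  linarith

lemma le_optValue {k : ℕ} (f : Finset (Fin n) → ℝ) {S : Finset (Fin n)} (hS : #S ≤ k) :
    f S ≤ optValue k f :=
  le_sup' f (mem_filter.2 ⟨mem_univ _, hS⟩)

/-- If there are at least `k` hidden elements, then `k` of them are almost worth `1`. -/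
lemma optValue_labelFn_ge {k m l d : ℕ} (hk : 0 < k) (hmk : m ≤ k) {a : Labelling n l d}
    (ha : k ≤ #(hiddenSet l d a)) :
    1 - max (m / k : ℝ) (cutoff k d) ≤ optValue k (labelFn k m l d a) := by
  have hk' : (0 : ℝ) < k := by exact_mod_cast hk
  obtain ⟨T, hT, hTk⟩ := exists_subset_card_eq ha
  refine le_trans ?_ (le_optValue _ hTk.le)
  unfold labelFn hardFn residual
  rw [sdiff_eq_empty_iff_subset.2 hT, inter_eq_left.2 hT, hTk, potential_empty, neg_zero,
    Real.exp_zero, one_mul, hiddenFactor_of_ge hmk]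
  gcongr
  have h1 : 1 - ((k : ℝ) - m) / k = m / k := by field_simp; ring
  rw [h1, max_eq_right (by positivity)]
  refine mul_le_of_le_one_left (by positivity) ?_
  rw [Real.exp_le_one_iff, neg_nonpos]
  positivity

lemma cutoff_lt_one {k : ℕ} (hk : 0 < k) (d : ℕ) : cutoff k d < 1 := by
  unfold cutoff
  have hk' : (0 : ℝ) < k := by exact_mod_cast hk
  rw [Real.exp_lt_one_iff, neg_lt_zero]
  positivity

lemma optValue_labelFn_pos (hn : 0 < n) {k : ℕ} (hk : 0 < k) (m l d : ℕ) (a : Labelling n l d) :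
    0 < optValue k (labelFn k m l d a) := by
  refine lt_of_lt_of_le ?_ (le_optValue _ (S := {⟨0, hn⟩}) (by rwa [card_singleton]))
  unfold labelFn hardFn
  rw [sub_pos, max_lt_iff]
  refine ⟨(residual_le_exp _ _ _ _ _ _).trans_lt ?_, cutoff_lt_one hk d⟩
  have hk' : (0 : ℝ) < k := by exact_mod_cast hk
  rw [Real.exp_lt_one_iff, neg_lt_zero, card_singleton]
  positivity

/-! ### The randomized instance -/

/-- The instance without information, needed for the empty ground set only. -/
noncomputable def trivialInstance (n : ℕ) : RandomInstance n where
  ι := Unit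
  fintype := inferInstance
  nonempty := inferInstance
  k := 0
  f := fun _ _ => 1
  nonneg := fun _ _ => zero_le_one
  monotone := fun _ => monotone_const
  submodular := fun _ S T _ e _ => by simp
  opt_pos := fun _ => zero_lt_one.trans_le (le_optValue (fun _ => (1 : ℝ)) (S := ∅) (by simp))

/-- The hard functions of all labellings. -/
noncomputable def labelInstance (hn : 0 < n) {k : ℕ} (hk : 0 < k) (m l d : ℕ) :
    RandomInstance n where
  ι := Labelling n l d
  fintype := inferInstance
  nonempty := ⟨fun _ => ⟨0, by positivity⟩⟩
  k := k
  f := labelFn k m l d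
  nonneg := fun _ _ => hardFn_nonneg (cutoff_lt_one hk d).le _ _ _
  monotone := fun _ => hardFn_monotone _ _ _ _ _ _
  submodular := fun _ => hardFn_isSubmodular _ _ _ _ _ _
  opt_pos := optValue_labelFn_pos hn hk m l d

open Classical in
/-- A deterministic algorithm of `r` rounds does well on a small fraction of the labellings only. -/
lemma card_good_le {k m l d r q : ℕ} (hr : 1 ≤ r) (hrl : r < l) (hk : 0 < k) (hmk : m ≤ k)
    (hm : ((r : ℝ) + 2) * (m / k) ≤ 1 / 40) (hn : 4 * k * 4 ^ (l + d) ≤ n)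
    {α : ℝ} (hα0 : 0 ≤ α)
    (hα : 1 - 1 / Real.exp 1 - 1 / (9600 * r) ≤ α * (1 - max (m / k : ℝ) (cutoff k d)))
    (A : AdaptiveAlgorithm n k q) :
    (#{a : Labelling n l d | α * optValue k (labelFn k m l d a) <
        labelFn k m l d a (A.run r (labelFn k m l d a))} : ℝ) ≤
      (1 / 2 ^ k + (r * q + 1) * ((l + 4) / 2 ^ m)) * Fintype.card (Labelling n l d) := by
  set H : Labelling n l d → ℕ → QueryHistory n := fun a => simHistory A (roundFn k m l d a) with hH
  have hHc : ∀ t (a a' : Labelling n l d), firstLayers l d t a = firstLayers l d t a' →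
      H a t = H a' t := fun t a a' h => simHistory_congr A fun s hs => roundFn_congr hs h
  have hsub : ({a : Labelling n l d | α * optValue k (labelFn k m l d a) <
        labelFn k m l d a (A.run r (labelFn k m l d a))} : Finset _) ⊆
      ({a | #(hiddenSet l d a) < k} : Finset _) ∪
      (((range r).biUnion fun t => {a | ∃ S ∈ A.queries (H a t), Unbalanced m l d t a S}) ∪
        ({a | ∃ S ∈ [A.output (H a r)], Unbalanced m l d r a S} : Finset _)) := by
    intro a ha
    by_contra hcon
    simp only [mem_union, mem_biUnion, mem_filter, mem_univ, true_and, mem_range, not_or,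
      not_lt, not_exists, not_and, List.mem_singleton] at hcon ha
    obtain ⟨h1, h2, h3⟩ := hcon
    have hrun : A.run r (labelFn k m l d a) = A.output (H a r) := by
      unfold AdaptiveAlgorithm.run
      rw [history_eq_simHistory A (v := roundFn k m l d a)]
      intro t ht S hS
      exact labelFn_eq_roundFn (by omega) (h2 t ht S hS)
    rw [hrun] at ha
    have h4 := labelFn_le_of_balanced hr hrl hk hm (A.card_output_le _) (h3 _ rfl)
    have h5 := mul_le_mul_of_nonneg_left (optValue_labelFn_ge (m := m) hk hmk h1) hα0
    linarith
  have hδ : (0 : ℝ) ≤ (l + 4) / 2 ^ m := by positivity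
  have hround : ∀ t ∈ range r,
      (#{a : Labelling n l d | ∃ S ∈ A.queries (H a t), Unbalanced m l d t a S} : ℝ) ≤
        q * ((l + 4) / 2 ^ m) * Fintype.card (Labelling n l d) := by
    intro t ht
    have ht' := mem_range.1 ht
    exact card_exists_mem_le (firstLayers l d t) (Unbalanced m l d t) hδ
      (card_unbalanced_le (by omega) m) (fun a => A.queries (H a t))
      (fun a a' h => by rw [hHc t a a' h]) fun a => A.length_queries_le _
  have hout : (#{a : Labelling n l d | ∃ S ∈ [A.output (H a r)], Unbalanced m l d r a S} : ℝ) ≤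
        (1 : ℕ) * ((l + 4) / 2 ^ m) * Fintype.card (Labelling n l d) :=
    card_exists_mem_le (firstLayers l d r) (Unbalanced m l d r) hδ
      (card_unbalanced_le hrl m) (fun a => [A.output (H a r)])
      (fun a a' h => by rw [hHc r a a' h]) fun a => by simp
  have h1 := (card_le_card hsub).trans ((card_union_le _ _).trans (add_le_add le_rfl
    ((card_union_le _ _).trans (add_le_add card_biUnion_le le_rfl))))
  refine (Nat.cast_le.2 h1).trans ?_
  push_cast
  have h2 := sum_le_sum hround
  rw [sum_const, card_range, nsmul_eq_mul] at h2
  refine (add_le_add (card_hiddenSet_lt_le hn) (add_le_add h2 hout)).trans (le_of_eq ?_)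
  push_cast
  ring

/-! ### Averaging over the seed -/

/-- The event that the returned set is worth more than `α` times the optimum is measurable. -/
lemma measurableSet_ratioGT {r q : ℕ} (I : RandomInstance n) (A : RandomizedAlgorithm n I.k r q)
    (α : ℝ) (i : I.ι) :
    MeasurableSet {ω | α * optValue I.k (I.f i) < I.f i ((A.alg ω).run r (I.f i))} := by
  have : {ω | α * optValue I.k (I.f i) < I.f i ((A.alg ω).run r (I.f i))} =
      ⋃ S ∈ ({S | α * optValue I.k (I.f i) < I.f i S} : Set (Finset (Fin n))),
        {ω | (A.alg ω).run r (I.f i) = S} := by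
    ext ω
    simp
  rw [this]
  exact MeasurableSet.biUnion (Set.to_countable _) fun S _ => A.measurable_run _ _

open Classical in
lemma probRatioGT_le {r q : ℕ} (I : RandomInstance n) (A : RandomizedAlgorithm n I.k r q)
    {α δ : ℝ} (h : ∀ B : AdaptiveAlgorithm n I.k q,
      (#{i | α * optValue I.k (I.f i) < I.f i (B.run r (I.f i))} : ℝ) ≤ δ * Fintype.card I.ι) :
    I.probRatioGT A α ≤ δ := by
  have hcard : (0 : ℝ) < Fintype.card I.ι := by exact_mod_cast Fintype.card_pos
  unfold RandomInstance.probRatioGT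
  rw [div_le_iff₀ hcard]
  have hE := measurableSet_ratioGT I A α
  set E : I.ι → Set A.Ω :=
    fun i => {ω | α * optValue I.k (I.f i) < I.f i ((A.alg ω).run r (I.f i))} with hEdef
  have hint : ∀ i, MeasureTheory.Integrable ((E i).indicator (1 : A.Ω → ℝ)) A.P := fun i =>
    (MeasureTheory.integrable_const (1 : ℝ)).indicator (hE i)
  calc ∑ i, A.P.real (E i) = ∑ i, ∫ ω, (E i).indicator (1 : A.Ω → ℝ) ω ∂A.P :=
        sum_congr rfl fun i _ => (MeasureTheory.integral_indicator_one (hE i)).symm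
    _ = ∫ ω, ∑ i, (E i).indicator (1 : A.Ω → ℝ) ω ∂A.P :=
        (MeasureTheory.integral_finsetSum _ fun i _ => hint i).symm
    _ ≤ ∫ _ω, δ * Fintype.card I.ι ∂A.P := by
        refine MeasureTheory.integral_mono (MeasureTheory.integrable_finsetSum _ fun i _ => hint i)
          (MeasureTheory.integrable_const _) fun ω => ?_
        refine le_trans (le_of_eq ?_) (h (A.alg ω))
        simp only [Set.indicator_apply, Pi.one_apply, hEdef, Set.mem_ofPred_eq]
        rw [sum_boole]
    _ = δ * Fintype.card I.ι := by simp

lemma probRatioGT_labelInstance_le (h0 : 0 < n) {k m l d r q : ℕ} (hr : 1 ≤ r) (hrl : r < l)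
    (hk : 0 < k) (hmk : m ≤ k) (hm : ((r : ℝ) + 2) * (m / k) ≤ 1 / 40)
    (hn : 4 * k * 4 ^ (l + d) ≤ n) {α : ℝ} (hα0 : 0 ≤ α)
    (hα : 1 - 1 / Real.exp 1 - 1 / (9600 * r) ≤ α * (1 - max (m / k : ℝ) (cutoff k d)))
    (A : RandomizedAlgorithm n (labelInstance h0 hk m l d).k r q) :
    (labelInstance h0 hk m l d).probRatioGT A α ≤
      1 / 2 ^ k + (r * q + 1) * ((l + 4) / 2 ^ m) :=
  probRatioGT_le _ A fun B => card_good_le hr hrl hk hmk hm hn hα0 hα B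

lemma expectedRatio_le {r q : ℕ} (I : RandomInstance n) (A : RandomizedAlgorithm n I.k r q)
    {α : ℝ} (hα : 0 ≤ α) : I.expectedRatio A ≤ α + I.probRatioGT A α := by
  classical
  have hcard : (0 : ℝ) < Fintype.card I.ι := by exact_mod_cast Fintype.card_pos
  unfold RandomInstance.expectedRatio RandomInstance.probRatioGT
  rw [div_le_iff₀ hcard, add_mul, div_mul_cancel₀ _ hcard.ne']
  have hsum : ∑ _i : I.ι, α = α * Fintype.card I.ι := by
    rw [sum_const, nsmul_eq_mul, card_univ, mul_comm]
  rw [← hsum, ← sum_add_distrib]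
  refine sum_le_sum fun i _ => ?_
  have hE := measurableSet_ratioGT I A α i
  set E : Set A.Ω := {ω | α * optValue I.k (I.f i) < I.f i ((A.alg ω).run r (I.f i))} with hEdef
  have hind : MeasureTheory.Integrable (E.indicator (1 : A.Ω → ℝ)) A.P :=
    (MeasureTheory.integrable_const (1 : ℝ)).indicator hE
  have hint : MeasureTheory.Integrable (fun ω => α + E.indicator (1 : A.Ω → ℝ) ω) A.P :=
    (MeasureTheory.integrable_const α).add hind
  have hint' : ∫ ω, (α + E.indicator (1 : A.Ω → ℝ) ω) ∂A.P = α + A.P.real E := by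
    rw [MeasureTheory.integral_add (MeasureTheory.integrable_const α) hind,
      MeasureTheory.integral_indicator_one hE]
    simp
  rw [← hint']
  refine MeasureTheory.integral_mono_of_nonneg (.of_forall fun ω => ?_) hint
    (.of_forall fun ω => ?_)
  · exact div_nonneg (I.nonneg _ _) (I.opt_pos i).le
  · have hle : I.f i ((A.alg ω).run r (I.f i)) ≤ optValue I.k (I.f i) :=
      le_optValue _ ((A.alg ω).card_output_le _)
    by_cases hω : ω ∈ E
    · simp only [Set.indicator_of_mem hω, Pi.one_apply]
      have := (div_le_one (I.opt_pos i)).2 hle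
      linarith
    · simp only [Set.indicator_of_notMem hω, add_zero]
      rw [div_le_iff₀ (I.opt_pos i)]
      exact not_lt.1 hω

/-! ### Choice of the parameters -/

lemma exists_forall_mul_le_two_pow (K : ℕ) : ∃ D₀, ∀ D ≥ D₀, K * (D + 1) ≤ 2 ^ D := by
  refine ⟨2 * K + 2, fun D hD => ?_⟩
  induction D, hD using Nat.le_induction with
  | base =>
    have h : K + 1 ≤ 2 ^ K := Nat.lt_two_pow_self
    calc K * (2 * K + 2 + 1) ≤ (K + 1) * (K + 1) * 4 := by nlinarith
      _ ≤ 2 ^ K * 2 ^ K * 4 := by gcongr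
      _ = 2 ^ (2 * K + 2) := by ring
  | succ D hD ih =>
    rw [pow_succ]
    nlinarith

lemma eval_le_mul_pow (p : Polynomial ℕ) {n : ℕ} (hn : 1 ≤ n) :
    p.eval n ≤ p.eval 1 * n ^ p.natDegree := by
  rw [Polynomial.eval_eq_sum_range, Polynomial.eval_eq_sum_range, sum_mul]
  refine sum_le_sum fun i hi => ?_
  rw [one_pow, mul_one]
  gcongr
  have := mem_range.1 hi
  omega

lemma cutoff_le (D : ℕ) : cutoff (4 ^ D) (2 * D) ≤ 2 / 2 ^ D := by
  unfold cutoff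
  have h : (4 : ℝ) ^ (2 * D) / ((4 ^ D : ℕ) : ℝ) = 2 ^ D * 2 ^ D := by
    push_cast
    rw [div_eq_iff (by positivity), ← mul_pow, ← mul_pow, pow_mul]
    norm_num
  have h1 : (1 : ℝ) ≤ 2 ^ D := one_le_pow₀ (by norm_num)
  rw [h, Real.exp_neg, inv_le_comm₀ (Real.exp_pos _) (by positivity), inv_div]
  nlinarith [Real.add_one_le_exp (13 / 16 * ((2 : ℝ) ^ D * 2 ^ D))]

/-- The hard instance on `n` elements. With `D` about `log₂ n / 24`, sets of at most `4 ^ D`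
elements are allowed, where `4 ^ D` is about `n ^ (1 / 12)`, and `8 * D + 8`, that is about
`log₂ n / 3`, layers are penalized. A label lies in the last layer with probability about `n ^ (-2 / 3)`,
and is that of the hidden set with probability about `n ^ (-5 / 6)`. The slack `2 ^ D` is large
enough for exponential tail bounds, and small compared with `4 ^ D`. -/
noncomputable def hardInstance (n : ℕ) : RandomInstance n :=
  if hn : 0 < n then
    labelInstance hn (k := 4 ^ (Nat.log 2 n / 24)) (by positivity) (2 ^ (Nat.log 2 n / 24))
      (8 * (Nat.log 2 n / 24) + 8) (2 * (Nat.log 2 n / 24))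
  else trivialInstance n

/-- The bound on the failure probability, for polynomially many queries. -/
lemma failure_le {D n r q C δ : ℕ} (hn0 : 0 < n) (hn : n ≤ 2 ^ (24 * (D + 1)))
    (hr : r ≤ 8 * (D + 1)) (hq : q ≤ C * n ^ δ) (hD : (46 + C + 24 * δ) * (D + 1) ≤ 2 ^ D) :
    1 / 2 ^ (4 ^ D) + (r * q + 1) * (((8 * D + 8 : ℕ) + 4) / 2 ^ (2 ^ D)) ≤ (1 / n : ℝ) := by
  have two_pow : ∀ x : ℕ, x ≤ 2 ^ x := fun x => Nat.lt_two_pow_self.le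
  have e1 : r ≤ 2 ^ (8 * (D + 1)) := hr.trans (two_pow _)
  have e2 : q ≤ 2 ^ ((C + 24 * δ) * (D + 1)) := by
    calc q ≤ C * n ^ δ := hq
      _ ≤ 2 ^ (C * (D + 1)) * (2 ^ (24 * (D + 1))) ^ δ := by
          gcongr
          exact (two_pow C).trans (Nat.pow_le_pow_right (by norm_num) (by nlinarith))
      _ = _ := by rw [← pow_mul, ← pow_add]; ring_nf
  have e3 : r * q + 1 ≤ 2 ^ ((9 + C + 24 * δ) * (D + 1)) := by
    calc r * q + 1 ≤ 2 ^ (8 * (D + 1)) * 2 ^ ((C + 24 * δ) * (D + 1)) +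
          2 ^ (8 * (D + 1)) * 2 ^ ((C + 24 * δ) * (D + 1)) :=
          add_le_add (Nat.mul_le_mul e1 e2) (Nat.one_le_iff_ne_zero.2 (by positivity))
      _ = 2 ^ ((8 + C + 24 * δ) * (D + 1) + 1) := by rw [← pow_add, pow_succ]; ring_nf
      _ ≤ _ := Nat.pow_le_pow_right (by norm_num) (by nlinarith)
  have e4 : 8 * D + 8 + 4 ≤ 2 ^ (12 * (D + 1)) := le_trans (by omega) (two_pow _)
  have e5 : 2 * n ≤ 2 ^ (25 * (D + 1)) := by
    calc 2 * n ≤ 2 * 2 ^ (24 * (D + 1)) := by gcongr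
      _ = 2 ^ (24 * (D + 1) + 1) := by rw [pow_succ]; ring
      _ ≤ _ := Nat.pow_le_pow_right (by norm_num) (by omega)
  have e6 : 2 * n * ((r * q + 1) * (8 * D + 8 + 4)) ≤ 2 ^ 2 ^ D := by
    calc _ ≤ 2 ^ (25 * (D + 1)) * (2 ^ ((9 + C + 24 * δ) * (D + 1)) * 2 ^ (12 * (D + 1))) := by
          gcongr
      _ = 2 ^ ((46 + C + 24 * δ) * (D + 1)) := by rw [← pow_add, ← pow_add]; ring_nf
      _ ≤ _ := Nat.pow_le_pow_right (by norm_num) hD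
  have e7 : 2 * n ≤ 2 ^ 4 ^ D := by
    refine e5.trans (Nat.pow_le_pow_right (by norm_num) ?_)
    calc 25 * (D + 1) ≤ (46 + C + 24 * δ) * (D + 1) := by gcongr; omega
      _ ≤ 2 ^ D := hD
      _ ≤ 4 ^ D := Nat.pow_le_pow_left (by norm_num) D
  have hn' : (0 : ℝ) < n := by exact_mod_cast hn0
  have f1 : (1 / 2 ^ (4 ^ D) : ℝ) ≤ 1 / (2 * n) := by
    refine one_div_le_one_div_of_le (by positivity) ?_
    exact_mod_cast e7
  have f2 : ((r : ℝ) * q + 1) * (((8 * D + 8 : ℕ) + 4) / 2 ^ (2 ^ D)) ≤ 1 / (2 * n) := by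
    rw [← mul_div_assoc, div_le_div_iff₀ (by positivity) (by positivity), one_mul, mul_comm]
    exact_mod_cast e6
  calc _ ≤ 1 / (2 * n) + 1 / (2 * n : ℝ) := add_le_add f1 f2
    _ = 1 / n := by field_simp; norm_num

lemma exists_probRatioGT_le (p : Polynomial ℕ) : ∃ n₀ : ℕ, ∀ n : ℕ, n₀ ≤ n →
    ∀ r : ℕ, 1 ≤ r → (r : ℝ) < (1 / 3 : ℝ) * Real.logb 2 (n : ℝ) →
      38400 * r ≤ n ∧ ∀ A : RandomizedAlgorithm n (hardInstance n).k r (p.eval n), ∀ α : ℝ,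
        1 - 1 / Real.exp 1 - 1 / (19200 * r) ≤ α → α ≤ 1 →
          (hardInstance n).probRatioGT A α ≤ 1 / n := by
  obtain ⟨D₀, hD₀⟩ :=
    exists_forall_mul_le_two_pow (1000000 + (46 + p.eval 1 + 24 * p.natDegree))
  refine ⟨2 ^ (24 * (D₀ + 9)), fun n hn r hr hrn => ?_⟩
  have hn0 : 0 < n := lt_of_lt_of_le (by positivity) hn
  have hI : hardInstance n = labelInstance hn0 (k := 4 ^ (Nat.log 2 n / 24)) (by positivity)
      (2 ^ (Nat.log 2 n / 24)) (8 * (Nat.log 2 n / 24) + 8) (2 * (Nat.log 2 n / 24)) :=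
    dif_pos hn0
  rw [hI]
  have hlog : 24 * (D₀ + 9) ≤ Nat.log 2 n := Nat.le_log_of_pow_le (by norm_num) hn
  have hn1 : n ≤ 2 ^ (24 * (Nat.log 2 n / 24 + 1)) :=
    (Nat.lt_pow_succ_log_self (by norm_num) n).le.trans
      (Nat.pow_le_pow_right (by norm_num) (by omega))
  have hn2 : 2 ^ (24 * (Nat.log 2 n / 24)) ≤ n :=
    (Nat.pow_le_pow_right (by norm_num) (by omega)).trans (Nat.pow_log_le_self 2 hn0.ne')
  -- needed for `4 * k * 4 ^ (l + d) ≤ n`, so that `4 * k` hidden elements are expected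
  have hD9 : 9 ≤ Nat.log 2 n / 24 := by omega
  have hDD : D₀ ≤ Nat.log 2 n / 24 := by omega
  generalize Nat.log 2 n / 24 = D at *
  have hD := hD₀ D hDD
  have hrD : r < 8 * D + 8 := by
    have h1 : Real.logb 2 n ≤ 24 * (D + 1) := by
      rw [Real.logb_le_iff_le_rpow (by norm_num) (by exact_mod_cast hn0)]
      have : (n : ℝ) ≤ 2 ^ (24 * (D + 1)) := by exact_mod_cast hn1
      refine this.trans (le_of_eq ?_)
      rw [← Real.rpow_natCast]
      push_cast
      rfl
    have h2 : (r : ℝ) < 8 * D + 8 := by linarith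
    exact_mod_cast h2
  have hr38 : 38400 * (r + 2) ≤ 2 ^ D :=
    calc 38400 * (r + 2) ≤ 1000000 * (D + 1) := by omega
      _ ≤ (1000000 + (46 + p.eval 1 + 24 * p.natDegree)) * (D + 1) :=
          Nat.mul_le_mul_right _ (Nat.le_add_right _ _)
      _ ≤ 2 ^ D := hD
  have hr0 : (1 : ℝ) ≤ r := by exact_mod_cast hr
  have hr38' : (38400 * (r + 2) : ℝ) ≤ 2 ^ D := by exact_mod_cast hr38
  refine ⟨?_, fun A α hα hα1 => ?_⟩
  · calc 38400 * r ≤ 38400 * (r + 2) := by omega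
      _ ≤ 2 ^ D := hr38
      _ ≤ 2 ^ (24 * D) := Nat.pow_le_pow_right (by norm_num) (by omega)
      _ ≤ n := hn2
  have hε : ((2 ^ D : ℕ) : ℝ) / ((4 ^ D : ℕ) : ℝ) = 1 / 2 ^ D := by
    push_cast
    rw [div_eq_div_iff (by positivity) (by positivity), one_mul, ← mul_pow]
    norm_num
  have hpow : (0 : ℝ) < 2 ^ D := by positivity
  have hmax : max (((2 ^ D : ℕ) : ℝ) / ((4 ^ D : ℕ) : ℝ)) (cutoff (4 ^ D) (2 * D)) ≤
      1 / (19200 * r) := by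
    have h2 : (2 : ℝ) / 2 ^ D ≤ 1 / (19200 * r) := by
      rw [div_le_div_iff₀ hpow (by positivity)]; linarith
    refine max_le ?_ ((cutoff_le D).trans h2)
    rw [hε]
    refine le_trans ?_ h2
    gcongr
    norm_num
  have he : 1 / Real.exp 1 ≤ 1 / 2 := by
    have := Real.exp_one_gt_d9
    exact one_div_le_one_div_of_le (by norm_num) (by linarith)
  have hsmall : 1 / (19200 * r : ℝ) ≤ 1 / 2 := by
    rw [div_le_div_iff₀ (by positivity) (by norm_num)]; linarith
  have hα0 : 0 ≤ α := by linarith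
  have hhalf : 1 / (9600 * r : ℝ) = 1 / (19200 * r) + 1 / (19200 * r) := by
    field_simp; norm_num
  have hfail := failure_le hn0 hn1 hrD.le (eval_le_mul_pow p hn0)
    ((Nat.mul_le_mul_right _ (Nat.le_add_left _ _)).trans hD)
  have hn3 : 4 * 4 ^ D * 4 ^ (8 * D + 8 + 2 * D) ≤ n := by
    refine le_trans (le_of_eq ?_) ((Nat.pow_le_pow_right (n := 2) (by norm_num)
      (show 22 * D + 18 ≤ 24 * D by omega)).trans hn2)
    rw [show 4 * 4 ^ D * 4 ^ (8 * D + 8 + 2 * D) = 4 ^ (11 * D + 9) by ring,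
      show 4 = 2 ^ 2 by norm_num, ← pow_mul]
    ring_nf
  refine (probRatioGT_labelInstance_le hn0 hr hrD (by positivity)
    (Nat.pow_le_pow_left (by norm_num) D) ?_ hn3 hα0 ?_ A).trans hfail
  · rw [hε, mul_one_div, div_le_div_iff₀ hpow (by norm_num)]
    linarith
  · rw [hhalf, mul_sub, mul_one]
    refine le_trans ?_ (sub_le_sub_left (mul_le_of_le_one_left ?_ hα1) α)
    · linarith only [hα, hmax]
    · exact le_max_of_le_right (Real.exp_pos _).le

end AdaptiveHardness

theorem mainTheorem1 :
    ∃ c : ℝ, 0 < c ∧ ∃ I : ∀ n : ℕ, RandomInstance n,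
      ∀ p : Polynomial ℕ, ∃ n₀ : ℕ, ∀ n : ℕ, n₀ ≤ n →
        ∀ r : ℕ, 1 ≤ r → (r : ℝ) < (1 / 3 : ℝ) * Real.logb 2 (n : ℝ) →
          ∀ A : RandomizedAlgorithm n (I n).k r (p.eval n),
            (I n).expectedRatio A ≤ 1 - 1 / Real.exp 1 - c / (r : ℝ) ∧
            (I n).probRatioGT A (1 - 1 / Real.exp 1 - c / (r : ℝ)) ≤ 1 / (n : ℝ) := by
  refine ⟨1 / 38400, by norm_num, AdaptiveHardness.hardInstance, fun p => ?_⟩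
  obtain ⟨n₀, h⟩ := AdaptiveHardness.exists_probRatioGT_le p
  refine ⟨n₀, fun n hn r hr hrn A => ?_⟩
  obtain ⟨hrn', hA⟩ := h n hn r hr hrn
  have hr0 : (1 : ℝ) ≤ r := by exact_mod_cast hr
  set x : ℝ := 1 / 38400 / r with hx
  have hx0 : 0 ≤ x := by positivity
  have hx1 : x ≤ 1 / 38400 := div_le_self (by norm_num) hr0
  have hx2 : 1 / (19200 * r : ℝ) = 2 * x := by rw [hx]; field_simp; norm_num
  have hxn : 1 / (n : ℝ) ≤ x := by
    have h1 : (38400 * r : ℝ) ≤ n := by exact_mod_cast hrn'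
    rw [hx, div_div]
    exact one_div_le_one_div_of_le (by positivity) h1
  have he : 1 / Real.exp 1 ≤ 1 / 2 := by
    have := Real.exp_one_gt_d9
    exact one_div_le_one_div_of_le (by norm_num) (by linarith)
  have he0 : 0 ≤ 1 / Real.exp 1 := by positivity
  refine ⟨?_, hA A _ (by linarith) (by linarith)⟩
  -- the slack `x` between the two thresholds pays for the failure probability
  have h1 := AdaptiveHardness.expectedRatio_le (AdaptiveHardness.hardInstance n) A
    (α := 1 - 1 / Real.exp 1 - 2 * x) (by linarith)
  have h2 := hA A (1 - 1 / Real.exp 1 - 2 * x) (by linarith) (by linarith)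
  linarith
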